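/- Conventions. Digraphs are finite and simple: there are no loops and no multiple arcs, but two opposite arcs $(v,w)$ and $(w,v)$ may both be present. A digraph is semi-complete if for any two distinct vertices $v,w$ at least one of the arcs $(v,w)$, $(w,v)$ is present. The cost of an ordering $(v_1,\ldots,v_n)$ of the vertices of a digraph $T$ is $\sum_{(v_i,v_j)\in E(T),\ i>j}(i-j)$. For a real number $r$, an $r$-cut of $T$ is a partition $(X,Y)$ of $V(T)$ (possibly with an empty part) such that at most $r$ arcs of $T$ have their tail in $Y$ and their head in $X$. Running time is the number of steps of a random access machine with addition and subtraction (no multiplication) at unit cost; the input is $n$, $k$ and the adjacency matrix of a digraph with vertex set $\{0,\ldots,n-1\}$. Theorem. There is an algorithm that, given a semi-complete digraph $T$ on $n$ vertices and an integer $k\ge 0$, in time $2^{O(k^{1/3}\sqrt{\log k})}\cdot n^{O(1)}$ either computes an ordering of $V(T)$ of cost at most $k$, or correctly reports that no such ordering exists. Here the time bound means that there is an absolute constant $c$ such that the number of steps is at most $c\cdot 2^{c\,k^{1/3}\sqrt{\log k}}\cdot (n+1)^{c}$ for all $n$, $k$ and $T$, where $k^{1/3}\sqrt{\log k}$ is read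 as $0$ for $k=0$. Moreover, only $(4k)^{2/3}$-cuts are relevant: if an ordering $(v_1,\ldots,v_n)$ of the vertices of a semi-complete digraph $T$ has cost at most $k$, then for every $0\le t\le n$ the partition $(\{v_1,\ldots,v_t\},\{v_{t+1},\ldots,v_n\})$ is a $(4k)^{2/3}$-cut of $T$. -/

import Mathlib

/-! ### Random access machines

A program is a structured random access machine (RAM) program. It works on registers and on a
separate memory, both holding natural numbers. The operations are constants, addition, (truncated)
subtraction and indirect reads and writes; there is no multiplication, so that a number grows by
at most one bit per step and counting every operation as one step is a reasonable (polynomially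
equivalent to Turing machines) measure of time. -/

namespace RAM

/-- Programs; `x`, `y`, `z` are names of registers. -/
inductive Prog : Type
  /-- do nothing -/
  | skip : Prog
  /-- `x := c` for a fixed number `c` -/
  | const (x c : ℕ) : Prog
  /-- `x := y + z` -/
  | add (x y z : ℕ) : Prog
  /-- `x := max (y - z) 0` -/
  | sub (x y z : ℕ) : Prog
  /-- `x := memory[y]` -/
  | load (x y : ℕ) : Prog
  /-- `memory[x] := y` -/
  | store (x y : ℕ) : Prog
  /-- first `p`, then `q` -/
  | seq (p q : Prog) : Prog
  /-- if `x ≠ 0` then `p` else `q` -/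
  | cond (x : ℕ) (p q : Prog) : Prog
  /-- while `x ≠ 0` do `p` -/
  | loop (x : ℕ) (p : Prog) : Prog

/-- The contents of the registers and of the memory. -/
structure State where
  reg : ℕ → ℕ
  mem : ℕ → ℕ

/-- Write `v` into register `x`. -/
def State.setReg (s : State) (x v : ℕ) : State :=
  { s with reg := Function.update s.reg x v }

/-- Write `v` into the memory cell with address `a`. -/
def State.setMem (s : State) (a v : ℕ) : State :=
  { s with mem := Function.update s.mem a v }

/-- `Runs p s s' t`: started in state `s`, the program `p` halts in state `s'` after exactly `t`
steps. Every elementary operation and every test of a register takes one step. -/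
inductive Runs : Prog → State → State → ℕ → Prop
  | skip (s : State) : Runs .skip s s 1
  | const (s : State) (x c : ℕ) : Runs (.const x c) s (s.setReg x c) 1
  | add (s : State) (x y z : ℕ) : Runs (.add x y z) s (s.setReg x (s.reg y + s.reg z)) 1
  | sub (s : State) (x y z : ℕ) : Runs (.sub x y z) s (s.setReg x (s.reg y - s.reg z)) 1
  | load (s : State) (x y : ℕ) : Runs (.load x y) s (s.setReg x (s.mem (s.reg y))) 1
  | store (s : State) (x y : ℕ) : Runs (.store x y) s (s.setMem (s.reg x) (s.reg y)) 1
  | seq {p q : Prog} {s s' s'' : State} {t t' : ℕ} :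
      Runs p s s' t → Runs q s' s'' t' → Runs (.seq p q) s s'' (t + t')
  | cond_then {x : ℕ} {p q : Prog} {s s' : State} {t : ℕ} :
      s.reg x ≠ 0 → Runs p s s' t → Runs (.cond x p q) s s' (t + 1)
  | cond_else {x : ℕ} {p q : Prog} {s s' : State} {t : ℕ} :
      s.reg x = 0 → Runs q s s' t → Runs (.cond x p q) s s' (t + 1)
  | loop_exit {x : ℕ} {p : Prog} {s : State} :
      s.reg x = 0 → Runs (.loop x p) s s 1
  | loop_iter {x : ℕ} {p : Prog} {s s' s'' : State} {t t' : ℕ} :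
      s.reg x ≠ 0 → Runs p s s' t → Runs (.loop x p) s' s'' t' →
      Runs (.loop x p) s s'' (t + t' + 1)

/-- Programs are deterministic: the final state and the number of steps are determined by the
program and the initial state. -/
theorem Runs.unique {p : Prog} {s s₁ s₂ : State} {t₁ t₂ : ℕ}
    (h₁ : Runs p s s₁ t₁) (h₂ : Runs p s s₂ t₂) : s₁ = s₂ ∧ t₁ = t₂ := by
  induction h₁ generalizing s₂ t₂ with
  | skip | const | add | sub | load | store => cases h₂; exact ⟨rfl, rfl⟩
  | seq _ _ ih ih' =>
    cases h₂ with
    | seq a b =>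
      obtain ⟨rfl, rfl⟩ := ih a
      obtain ⟨rfl, rfl⟩ := ih' b
      exact ⟨rfl, rfl⟩
  | cond_then h _ ih =>
    cases h₂ with
    | cond_then _ a => obtain ⟨rfl, rfl⟩ := ih a; exact ⟨rfl, rfl⟩
    | cond_else h' _ => exact absurd h' h
  | cond_else h _ ih =>
    cases h₂ with
    | cond_then h' _ => exact absurd h h'
    | cond_else _ a => obtain ⟨rfl, rfl⟩ := ih a; exact ⟨rfl, rfl⟩
  | loop_exit h =>
    cases h₂ with
    | loop_exit _ => exact ⟨rfl, rfl⟩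
    | loop_iter h' _ _ => exact absurd h h'
  | loop_iter h _ _ ih ih' =>
    cases h₂ with
    | loop_exit h' => exact absurd h' h
    | loop_iter _ a b =>
      obtain ⟨rfl, rfl⟩ := ih a
      obtain ⟨rfl, rfl⟩ := ih' b
      exact ⟨rfl, rfl⟩

end RAM

/-! ### Semi-complete digraphs, vertex orderings and cuts -/

namespace OLA

/-- A digraph without loops (a `Digraph` has no multiple arcs) in which any two distinct vertices
are joined by at least one arc. Both of the two opposite arcs may be present. -/
def IsSemicomplete {V : Type*} (T : Digraph V) : Prop :=
  (∀ v, ¬ T.Adj v v) ∧ ∀ v w, v ≠ w → T.Adj v w ∨ T.Adj w v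

open Classical in
/-- The cost of the ordering `σ 0, σ 1, …, σ (n - 1)` of the vertices: every arc that is directed
backward, from `σ i` to `σ j` with `j < i`, contributes its length `i - j`. -/
noncomputable def cost {V : Type*} {n : ℕ} (T : Digraph V) (σ : Fin n ≃ V) : ℕ :=
  ∑ i : Fin n, ∑ j : Fin n, if T.Adj (σ i) (σ j) ∧ j < i then (i : ℕ) - (j : ℕ) else 0

/-- The partition `(X, Xᶜ)` of the vertex set is an `r`-cut: at most `r` arcs have their tail in
`Xᶜ` and their head in `X`. -/
def IsCut {V : Type*} [Finite V] (T : Digraph V) (r : ℝ) (X : Set V) : Prop :=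
  ({p : V × V | T.Adj p.1 p.2 ∧ p.1 ∈ Xᶜ ∧ p.2 ∈ X}.ncard : ℝ) ≤ r

/-- The set of the first `t` vertices of an ordering. -/
def firstVertices {V : Type*} {n : ℕ} (σ : Fin n ≃ V) (t : ℕ) : Set V :=
  {v | ((σ.symm v : Fin n) : ℕ) < t}

open Classical in
/-- The initial state of a machine on the input `(T, k)`: register `0` holds the number `n` of
vertices, register `1` holds `k`, the memory cells with addresses `0, …, n * n - 1` hold the
adjacency matrix of `T` row by row, and all else is `0`. -/
noncomputable def inputState {n : ℕ} (T : Digraph (Fin n)) (k : ℕ) : RAM.State where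
  reg x := if x = 0 then n else if x = 1 then k else 0
  mem a := if ∃ i j : Fin n, a = (i : ℕ) * n + (j : ℕ) ∧ T.Adj i j then 1 else 0

/-- The final state `s` reports the ordering `σ`: register `0` holds `1`, and the memory cells
with addresses `0, …, n - 1` list the vertices in the order given by `σ`. -/
def Reports {n : ℕ} (s : RAM.State) (σ : Fin n ≃ Fin n) : Prop :=
  s.reg 0 = 1 ∧ ∀ i : Fin n, s.mem (i : ℕ) = (σ i : ℕ)

/-- The final state `s` reports that there is no ordering as desired: register `0` holds `0`. -/
def ReportsNone (s : RAM.State) : Prop :=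
  s.reg 0 = 0

end OLA

/-! ### Costs and cut sizes along an ordering -/

namespace OLA

open Finset

/-! A backward arc of length `l` crosses exactly `l` of the cuts between initial and final segments,
so the cost of an ordering is the sum of the sizes of these cuts (`cost_eq_sum_cutSize`). An
ordering of cost at most `k` is therefore a path from the empty set to the full vertex set that adds
one vertex at a time and pays the cut size of every set it enters.

Such a path meets only small cuts. A cut crossed by `m` backward arcs has at most about `m / 2` of
them within distance `√(m / 2)` of the boundary; the others are long, so the cost is of order at
least `m ^ (3 / 2)` (`cutSize_initialSet_pow_le`). If `k ≤ s ^ 3`, all cuts on the path have size at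
most `3 * s ^ 2`.

If a cheap ordering exists, there are few such cuts altogether. Relative to that ordering, a set `X`
of small cut size has few pairs of positions more than `s` apart with the earlier one outside and
the later one inside `X`: by semi-completeness each such pair gives an arc of the cut of `X` or a
long backward arc (`card_farInversions_le`). Hence `X` differs from an initial segment of the same
cardinality only in positions whose distances from the boundary, reduced by `s`, have sum `O(s ^ 2)`
(`sum_excess_le`). A generating function bounds the number of such position sets by `2 ^ (18 * s)`
(`card_filter_sum_excess_le`), so there are at most `(n + 1) * 2 ^ (18 * s)` relevant cuts.

The algorithm takes the least `r ≥ 1` with `k ≤ r ^ 3` and searches breadth first through pairs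
(set, cost so far). It keeps one path for each pair and gives up when more than `(n + 1) * 2 ^ (22 *
r)` pairs have appeared, since this excludes a cheap ordering (`Searching.not_exists`). A pair is
coded by one number, which serves as an address in a table of visited pairs; this table is sparse
and initially zero, so large addresses cost no time.

The remainder is program verification: a triple `Halts` bounding time and describing the final
state, with rules for the program constructs. The resulting time is `1000 * (n + 1) ^ 4 * 2 ^ (22 *
r)`; the factor `√(log k)` of the theorem is only a weakening. -/

open Classical in
/-- The number of arcs from the complement of `X` to `X`. -/
noncomputable def cutSize {n : ℕ} (T : Digraph (Fin n)) (X : Finset (Fin n)) : ℕ :=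
  ∑ y, ∑ x, if y ∉ X ∧ x ∈ X ∧ T.Adj y x then 1 else 0

/-- The set of the first `t` vertices of an ordering, as a `Finset`. -/
def initialSet {n : ℕ} (σ : Fin n ≃ Fin n) (t : ℕ) : Finset (Fin n) :=
  univ.filter fun v => (σ.symm v : ℕ) < t

theorem mem_initialSet {n : ℕ} {σ : Fin n ≃ Fin n} {t : ℕ} {v : Fin n} :
    v ∈ initialSet σ t ↔ (σ.symm v : ℕ) < t := by
  simp [initialSet]

open Classical in
theorem cutSize_initialSet {n : ℕ} (T : Digraph (Fin n)) (σ : Fin n ≃ Fin n) (t : ℕ) :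
    cutSize T (initialSet σ t) =
      ∑ i : Fin n, ∑ j : Fin n, if t ≤ (i : ℕ) ∧ (j : ℕ) < t ∧ T.Adj (σ i) (σ j) then 1 else 0 := by
  unfold cutSize
  rw [← Equiv.sum_comp σ]
  refine sum_congr rfl fun i _ => ?_
  rw [← Equiv.sum_comp σ]
  simp [mem_initialSet]

/-- Double counting: a backward arc from position `i` to position `j` crosses the cuts after the
first `t + 1` vertices exactly for `j ≤ t < i`. -/
theorem cost_eq_sum_cutSize {n : ℕ} (T : Digraph (Fin n)) (σ : Fin n ≃ Fin n) :
    cost T σ = ∑ t ∈ range n, cutSize T (initialSet σ (t + 1)) := by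
  classical
  simp_rw [cutSize_initialSet]
  rw [sum_comm]
  unfold cost
  refine sum_congr rfl fun i _ => ?_
  rw [sum_comm]
  refine sum_congr rfl fun j _ => ?_
  rw [← sum_filter, sum_const, smul_eq_mul, mul_one]
  split_ifs with h
  · have : (range n).filter (fun t => t + 1 ≤ (i : ℕ) ∧ (j : ℕ) < t + 1 ∧ T.Adj (σ i) (σ j)) =
        Ico (j : ℕ) i := by
      ext t
      simp only [mem_filter, mem_range, mem_Ico, h.1, and_true]
      have := i.2
      omega
    rw [this, Nat.card_Ico]
  · symm
    rw [card_eq_zero, filter_eq_empty_iff]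
    rintro t - ⟨h1, h2, h3⟩
    exact h ⟨h3, Fin.lt_def.2 (by omega)⟩

open Classical in
theorem cost_eq_sum_backward {n : ℕ} (T : Digraph (Fin n)) (σ : Fin n ≃ Fin n) :
    cost T σ = ∑ p ∈ univ.filter (fun p : Fin n × Fin n => T.Adj (σ p.1) (σ p.2) ∧ p.2 < p.1),
      ((p.1 : ℕ) - (p.2 : ℕ)) := by
  rw [sum_filter, ← univ_product_univ, sum_product]
  rfl

open Classical in
theorem mul_card_le_cost {n : ℕ} (T : Digraph (Fin n)) (σ : Fin n ≃ Fin n) (d : ℕ)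
    (S : Finset (Fin n × Fin n))
    (hS : ∀ p ∈ S, T.Adj (σ p.1) (σ p.2) ∧ (p.2 : ℕ) + d ≤ p.1 ∧ p.2 < p.1) :
    S.card * d ≤ cost T σ := by
  rw [cost_eq_sum_backward]
  calc S.card * d = ∑ p ∈ S, d := by simp
    _ ≤ ∑ p ∈ S, ((p.1 : ℕ) - (p.2 : ℕ)) :=
        sum_le_sum fun p hp => by have := (hS p hp).2; omega
    _ ≤ _ := sum_le_sum_of_subset fun p hp => by
        simp only [mem_filter, mem_univ, true_and]
        exact ⟨(hS p hp).1, (hS p hp).2.2⟩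

/-- At least half of the arcs of the cut leave the box of side `a` around the boundary and so have
length at least `a + 1`, where `(a + 1) ^ 2` exceeds the integer part of `m / 2`. -/
theorem cutSize_initialSet_pow_le {n : ℕ} (T : Digraph (Fin n)) (σ : Fin n ≃ Fin n) (t : ℕ) :
    cutSize T (initialSet σ t) ^ 3 ≤ 16 * cost T σ ^ 2 := by
  classical
  set E : Finset (Fin n × Fin n) := univ.filter fun p =>
    t ≤ (p.1 : ℕ) ∧ (p.2 : ℕ) < t ∧ T.Adj (σ p.1) (σ p.2) with hE
  have hm : cutSize T (initialSet σ t) = E.card := by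
    rw [cutSize_initialSet, card_filter, ← univ_product_univ, sum_product]
  rw [hm]
  set m := E.card
  -- The largest box that can hold at most half of the arcs: it has `a * a ≤ m / 2` pairs of
  -- positions.
  set a := Nat.sqrt (m / 2)
  have ha1 : a * a ≤ m / 2 := Nat.sqrt_le _
  have ha2 : m / 2 < (a + 1) * (a + 1) := Nat.lt_succ_sqrt _
  set S := E.filter fun p => ¬ ((p.1 : ℕ) < t + a ∧ t ≤ (p.2 : ℕ) + a)
  have hbox : (E.filter fun p => ((p.1 : ℕ) < t + a ∧ t ≤ (p.2 : ℕ) + a)).card ≤ a * a := by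
    have : (Ico t (t + a) ×ˢ Ico (t - a) t).card ≤ a * a := by
      rw [card_product, Nat.card_Ico, Nat.card_Ico]
      gcongr <;> omega
    refine le_trans (card_le_card_of_injOn (fun p => ((p.1 : ℕ), (p.2 : ℕ))) ?_ ?_) this
    · intro p hp
      simp only [hE, coe_filter, mem_filter, mem_univ, true_and, Set.mem_ofPred_eq] at hp
      simp only [coe_product, coe_Ico, Set.mem_prod, Set.mem_Ico]
      omega
    · rintro ⟨p1, p2⟩ - ⟨q1, q2⟩ - h
      simp only [Prod.mk.injEq] at h
      ext <;> simp [h.1, h.2]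
  have hsplit := card_filter_add_card_filter_not (s := E)
    (fun p => ((p.1 : ℕ) < t + a ∧ t ≤ (p.2 : ℕ) + a))
  have hS : S.card * (a + 1) ≤ cost T σ := by
    refine mul_card_le_cost T σ (a + 1) S fun p hp => ?_
    simp only [S, hE, mem_filter, mem_univ, true_and] at hp
    obtain ⟨⟨h1, h2, h3⟩, h4⟩ := hp
    exact ⟨h3, by omega, Fin.lt_def.2 (by omega)⟩
  have h1 : m ≤ 2 * S.card := by
    have : S.card = (E.filter fun p => ¬ ((p.1 : ℕ) < t + a ∧ t ≤ (p.2 : ℕ) + a)).card := rfl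
    omega
  have h2 : m ≤ 2 * ((a + 1) * (a + 1)) := by omega
  calc m ^ 3 = m * m * m := by ring
    _ ≤ (2 * S.card) * (2 * S.card) * (2 * ((a + 1) * (a + 1))) := by gcongr
    _ = 8 * (S.card * (a + 1)) ^ 2 := by ring
    _ ≤ 16 * cost T σ ^ 2 := by gcongr; norm_num

theorem cutSize_eq_ncard {n : ℕ} (T : Digraph (Fin n)) (X : Finset (Fin n)) :
    {p : Fin n × Fin n | T.Adj p.1 p.2 ∧ p.1 ∈ (X : Set (Fin n))ᶜ ∧ p.2 ∈ (X : Set (Fin n))}.ncard =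
      cutSize T X := by
  classical
  have : {p : Fin n × Fin n | T.Adj p.1 p.2 ∧ p.1 ∈ (X : Set (Fin n))ᶜ ∧ p.2 ∈ (X : Set (Fin n))} =
      ((univ : Finset (Fin n × Fin n)).filter fun p => p.1 ∉ X ∧ p.2 ∈ X ∧ T.Adj p.1 p.2 : Finset _) := by
    ext p
    simp only [Set.mem_ofPred_eq, coe_filter, mem_univ, true_and, Set.mem_compl_iff, mem_coe]
    tauto
  rw [this, Set.ncard_coe_finset, card_filter, ← univ_product_univ, sum_product]
  rfl

theorem isCut_firstVertices {n : ℕ} (T : Digraph (Fin n)) (k : ℕ) (σ : Fin n ≃ Fin n)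
    (h : cost T σ ≤ k) (t : ℕ) :
    IsCut T ((4 * (k : ℝ)) ^ (2 / 3 : ℝ)) (firstVertices σ t) := by
  have hX : firstVertices σ t = (initialSet σ t : Set (Fin n)) := by
    ext v; simp [firstVertices, initialSet]
  unfold IsCut
  rw [hX, cutSize_eq_ncard]
  have h3 : (cutSize T (initialSet σ t) : ℝ) ^ 3 ≤ (4 * (k : ℝ)) ^ 2 := by
    have h4 : cutSize T (initialSet σ t) ^ 3 ≤ 16 * k ^ 2 :=
      (cutSize_initialSet_pow_le T σ t).trans (by gcongr)
    have h5 : (cutSize T (initialSet σ t) : ℝ) ^ 3 ≤ 16 * (k : ℝ) ^ 2 := by exact_mod_cast h4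
    linarith
  set m : ℝ := (cutSize T (initialSet σ t) : ℝ)
  have hm : 0 ≤ m := Nat.cast_nonneg _
  calc m = (m ^ 3) ^ (1 / 3 : ℝ) := by
        rw [← Real.rpow_natCast, ← Real.rpow_mul hm]; norm_num
    _ ≤ ((4 * (k : ℝ)) ^ 2) ^ (1 / 3 : ℝ) := by gcongr
    _ = (4 * (k : ℝ)) ^ (2 / 3 : ℝ) := by
        rw [← Real.rpow_natCast, ← Real.rpow_mul (by positivity)]; norm_num

/-- An integral form of the bound that the program can compute: the constant works because `16 < 3 ^
3`. -/
theorem cutSize_initialSet_le {n : ℕ} (T : Digraph (Fin n)) {k s : ℕ} (hks : k ≤ s ^ 3)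
    (σ : Fin n ≃ Fin n) (h : cost T σ ≤ k) (t : ℕ) :
    cutSize T (initialSet σ t) ≤ 3 * s ^ 2 := by
  by_contra! hlt
  have h1 := cutSize_initialSet_pow_le T σ t
  have h2 : cost T σ ^ 2 ≤ (s ^ 3) ^ 2 := Nat.pow_le_pow_left (h.trans hks) 2
  have h3 : (3 * s ^ 2 + 1) ^ 3 ≤ cutSize T (initialSet σ t) ^ 3 := Nat.pow_le_pow_left hlt 3
  have h4 : 16 * (s ^ 3) ^ 2 < (3 * s ^ 2 + 1) ^ 3 := by ring_nf; nlinarith [sq_nonneg (s ^ 3), Nat.zero_le (s^2), Nat.zero_le (s^4)]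
  omega

/-! ### Counting cuts -/

/-- Pairs of positions more than `s` apart that appear in the wrong order. -/
def farInversions {n : ℕ} (s : ℕ) (Z : Finset (Fin n)) : Finset (Fin n × Fin n) :=
  univ.filter fun p => p.1 ∉ Z ∧ p.2 ∈ Z ∧ (p.1 : ℕ) + s < p.2

-- A far inversion `(p, q)` either has the arc from `σ p` to `σ q`, which lies in the cut of `X`, or
-- the opposite arc, which is backward of length more than `s`. Since the cost is at most `s ^ 3`,
-- there are at most `s ^ 2` arcs of the second kind.
open Classical in
theorem card_farInversions_le {n : ℕ} {T : Digraph (Fin n)} (hT : IsSemicomplete T) {k s : ℕ}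
    (hks : k ≤ s ^ 3) (σ : Fin n ≃ Fin n) (h : cost T σ ≤ k) (X : Finset (Fin n)) :
    (farInversions s (X.map σ.symm.toEmbedding)).card ≤ cutSize T X + s ^ 2 := by
  set F := farInversions s (X.map σ.symm.toEmbedding)
  have hF : ∀ p ∈ F, σ p.1 ∉ X ∧ σ p.2 ∈ X ∧ (p.1 : ℕ) + s < p.2 := by
    intro p hp
    simpa [F, farInversions, Equiv.symm_apply_eq] using hp
  rw [← card_filter_add_card_filter_not (s := F) (fun p => T.Adj (σ p.1) (σ p.2))]
  have h1 : (F.filter fun p => T.Adj (σ p.1) (σ p.2)).card ≤ cutSize T X := by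
    have : cutSize T X = ((univ : Finset (Fin n × Fin n)).filter
        fun p => p.1 ∉ X ∧ p.2 ∈ X ∧ T.Adj p.1 p.2).card := by
      rw [card_filter, ← univ_product_univ, sum_product]; rfl
    rw [this]
    refine card_le_card_of_injOn (fun p => (σ p.1, σ p.2)) ?_ ?_
    · intro p hp
      simp only [coe_filter, Set.mem_ofPred_eq] at hp
      have := hF p hp.1
      simp [this.1, this.2.1, hp.2]
    · rintro ⟨p1, p2⟩ - ⟨q1, q2⟩ - h
      simpa using h
  have h2 : (F.filter fun p => ¬ T.Adj (σ p.1) (σ p.2)).card * (s + 1) ≤ cost T σ := by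
    set G := F.filter fun p => ¬ T.Adj (σ p.1) (σ p.2)
    rw [← card_map (Equiv.prodComm _ _).toEmbedding]
    refine mul_card_le_cost T σ (s + 1) _ ?_
    rintro ⟨a, b⟩ hp
    simp only [mem_map_equiv, Equiv.prodComm_symm, Equiv.prodComm_apply, Prod.swap_prod_mk, G,
      mem_filter] at hp
    have h3 := hF _ hp.1
    simp only at h3
    have hne : σ a ≠ σ b := by
      intro he
      have := σ.injective he
      subst this
      omega
    refine ⟨(hT.2 _ _ hne).resolve_right hp.2, ?_, Fin.lt_def.2 ?_⟩ <;> dsimp only <;> omega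
  have h3 : (F.filter fun p => ¬ T.Adj (σ p.1) (σ p.2)).card ≤ s ^ 2 := by
    by_contra! h4
    have : (s ^ 2 + 1) * (s + 1) ≤ s ^ 3 :=
      (Nat.mul_le_mul_right _ h4).trans (h2.trans (h.trans hks))
    have : (s ^ 2 + 1) * (s + 1) = s ^ 3 + s ^ 2 + s + 1 := by ring
    omega
  omega

/-- The distance of the position `p` from the boundary before position `t`, reduced by `s`. -/
def excess (s t p : ℕ) : ℕ := if p < t then t - p - s else p + 1 - t - s

/-- Pigeonhole. A position `p < t` missing from `Z` has too few positions up to `p + s` to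
accommodate the `t` elements of `Z`, so at least `t - p - s` of them form far inversions with `p`.
Symmetrically for a position of `Z` beyond the boundary. Each of the two kinds uses every far
inversion at most once, whence the factor `2`. -/
theorem sum_excess_le {n : ℕ} (s : ℕ) (Z : Finset (Fin n)) :
    ∑ p ∈ univ.filter (fun p : Fin n => ¬ (p ∈ Z ↔ (p : ℕ) < Z.card)), excess s Z.card p ≤
      2 * (farInversions s Z).card := by
  classical
  set t := Z.card
  have h1 : ∑ p ∈ univ.filter (fun p : Fin n => p ∉ Z ∧ (p : ℕ) < t), excess s t p ≤
      (farInversions s Z).card := by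
    rw [card_eq_sum_card_fiberwise (f := Prod.fst) (t := univ.filter (fun p : Fin n => p ∉ Z))
      (by intro p hp; simp [farInversions] at hp ⊢; exact hp.1)]
    refine (sum_le_sum fun p hp => ?_).trans (sum_le_sum_of_subset (fun p hp => ?_))
    · simp only [mem_filter, mem_univ, true_and] at hp
      have hcard : t ≤ (p + s) + ((farInversions s Z).filter fun q => q.1 = p).card := by
        have e1 : Z.card = (Z.filter fun q : Fin n => (q : ℕ) ≤ p + s).card +
            (Z.filter fun q : Fin n => ¬ (q : ℕ) ≤ p + s).card :=
          (card_filter_add_card_filter_not _).symm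
        -- Not `p + s + 1`, because `p` itself is outside `Z`.
        have e2 : (Z.filter fun q : Fin n => (q : ℕ) ≤ p + s).card ≤ p + s := by
          have : ((range (p + s + 1)).erase p).card = p + s := by
            rw [card_erase_of_mem (by simp)]; simp
          rw [← this]
          refine card_le_card_of_injOn (fun q : Fin n => (q : ℕ)) ?_ (fun a _ b _ h => Fin.ext h)
          intro q hq
          simp only [coe_filter, Set.mem_ofPred_eq] at hq
          simp only [coe_erase, coe_range, Set.mem_sdiff, Set.mem_Iio, Set.mem_singleton_iff]
          refine ⟨by omega, fun h => hp.1 ?_⟩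
          rw [← Fin.ext h]; exact hq.1
        have e3 : (Z.filter fun q : Fin n => ¬ (q : ℕ) ≤ p + s).card ≤
            ((farInversions s Z).filter fun q => q.1 = p).card := by
          refine card_le_card_of_injOn (fun q => (p, q)) ?_ (fun a _ b _ h => by simpa using h)
          intro q hq
          simp only [coe_filter, Set.mem_ofPred_eq, not_le] at hq
          simp [farInversions, hp.1, hq.1, hq.2]
        omega
      simp only [excess, hp.2, if_true]
      omega
    · simp only [mem_filter, mem_univ, true_and] at hp ⊢
      exact hp.1
  have h2 : ∑ p ∈ univ.filter (fun p : Fin n => p ∈ Z ∧ ¬ (p : ℕ) < t), excess s t p ≤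
      (farInversions s Z).card := by
    rw [card_eq_sum_card_fiberwise (f := Prod.snd) (t := Z)
      (by intro p hp; simp [farInversions] at hp ⊢; exact hp.2.1)]
    refine (sum_le_sum fun p hp => ?_).trans (sum_le_sum_of_subset (fun p hp => ?_))
    · simp only [mem_filter, mem_univ, true_and] at hp
      have hcard : (p : ℕ) - s ≤ (t - 1) + ((farInversions s Z).filter fun q => q.2 = p).card := by
        set I := (univ : Finset (Fin n)).filter fun q : Fin n => (q : ℕ) + s < p
        have e0 : I.card = (p : ℕ) - s := by
          have : I.map Fin.valEmbedding = range ((p : ℕ) - s) := by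
            ext q
            simp only [I, mem_map, mem_filter, mem_univ, true_and, Fin.valEmbedding_apply, mem_range]
            constructor
            · rintro ⟨a, ha, rfl⟩; omega
            · intro h; exact ⟨⟨q, by omega⟩, by simp; omega, rfl⟩
          rw [← card_map, this, card_range]
        have e1 : I.card = (I.filter fun q => q ∈ Z).card + (I.filter fun q => ¬ q ∈ Z).card :=
          (card_filter_add_card_filter_not _).symm
        -- One is saved because `p` is in `Z` but not in `I`; this is the `+ 1` in the second case
        -- of `excess`.
        have e2 : (I.filter fun q => q ∈ Z).card ≤ t - 1 := by
          rw [← card_erase_of_mem hp.1]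
          refine card_le_card fun q hq => ?_
          simp only [I, mem_filter, mem_univ, true_and] at hq
          refine mem_erase.2 ⟨?_, hq.2⟩
          rintro rfl
          omega
        have e3 : (I.filter fun q => ¬ q ∈ Z).card ≤
            ((farInversions s Z).filter fun q => q.2 = p).card := by
          refine card_le_card_of_injOn (fun q => (q, p)) ?_ (fun a _ b _ h => by simpa using h)
          intro q hq
          simp only [I, coe_filter, mem_filter, mem_univ, true_and, Set.mem_ofPred_eq] at hq
          simp [farInversions, hp.1, hq.1, hq.2]
        omega
      have : 0 < t := card_pos.2 ⟨p, hp.1⟩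
      simp only [excess, hp.2, if_false]
      omega
    · simp only [mem_filter, mem_univ, true_and] at hp ⊢
      exact hp.1
  have h3 : univ.filter (fun p : Fin n => ¬ (p ∈ Z ↔ (p : ℕ) < t)) =
      univ.filter (fun p : Fin n => p ∉ Z ∧ (p : ℕ) < t) ∪
      univ.filter (fun p : Fin n => p ∈ Z ∧ ¬ (p : ℕ) < t) := by
    ext p
    simp only [mem_filter, mem_univ, true_and, mem_union]
    tauto
  rw [h3, sum_union]
  · omega
  · rw [disjoint_filter]
    tauto

/-! ### Counting position sets with a generating function -/

/-- The first `s` terms are at most `1` each, and the rest is part of a geometric series with ratio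
`s / (s + 1)` and sum `s`. -/
theorem sum_pow_sub_le {s : ℕ} (hs : 1 ≤ s) (m : ℕ) :
    ∑ j ∈ range m, ((s : ℝ) / (s + 1)) ^ (j + 1 - s) ≤ 2 * s := by
  set x : ℝ := (s : ℝ) / (s + 1) with hx
  have hs' : (0 : ℝ) < s := by exact_mod_cast hs
  have hx0 : 0 ≤ x := by positivity
  have hx1 : x ≤ 1 := by rw [hx, div_le_one (by positivity)]; linarith
  have hgeo : ∀ m : ℕ, ∑ j ∈ range m, x ^ (j + 1) = s * (1 - x ^ m) := by
    intro m
    induction m with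
    | zero => simp
    | succ m ih =>
      rw [sum_range_succ, ih, pow_succ]
      have : x * (s + 1) = s := by rw [hx]; field_simp
      linear_combination x ^ m * this
  calc ∑ j ∈ range m, x ^ (j + 1 - s) ≤ ∑ j ∈ range (s + m), x ^ (j + 1 - s) :=
        sum_le_sum_of_subset_of_nonneg (range_mono (by omega)) fun _ _ _ => by positivity
    _ = ∑ j ∈ range s, x ^ (j + 1 - s) + ∑ j ∈ range m, x ^ (j + 1) := by
        rw [sum_range_add]
        congr 1
        refine sum_congr rfl fun j _ => ?_
        congr 1; omega
    _ ≤ ∑ j ∈ range s, (1 : ℝ) + s * (1 - x ^ m) := by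
        rw [hgeo]
        gcongr
        exact pow_le_one₀ hx0 hx1
    _ ≤ 2 * s := by
        have : 0 ≤ s * x ^ m := by positivity
        simp only [sum_const, card_range, nsmul_eq_mul, mul_one]
        linarith

theorem sum_pow_excess_le {s : ℕ} (hs : 1 ≤ s) {n t : ℕ} (ht : t ≤ n) :
    ∑ p : Fin n, ((s : ℝ) / (s + 1)) ^ excess s t p ≤ 4 * s := by
  rw [← Finset.sum_range (f := fun p => ((s : ℝ) / (s + 1)) ^ excess s t p)]
  obtain ⟨r, rfl⟩ := Nat.exists_eq_add_of_le ht
  rw [sum_range_add]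
  have h1 : ∑ p ∈ range t, ((s : ℝ) / (s + 1)) ^ excess s t p ≤ 2 * s := by
    rw [← sum_range_reflect]
    refine le_trans (le_of_eq (sum_congr rfl fun j hj => ?_)) (sum_pow_sub_le hs t)
    have := mem_range.1 hj
    congr 1
    unfold excess
    rw [if_pos (by omega)]
    omega
  have h2 : ∑ p ∈ range r, ((s : ℝ) / (s + 1)) ^ excess s t (t + p) ≤ 2 * s := by
    refine le_trans (le_of_eq (sum_congr rfl fun j hj => ?_)) (sum_pow_sub_le hs r)
    congr 1
    unfold excess
    rw [if_neg (by omega)]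
    omega
  linarith

/-- Weight every set `D` by `x` to the power of its total excess, with `x = s / (s + 1)`. The total
weight of all sets factors as a product of terms `1 + x ^ excess` and is at most `exp (4 * s)`,
while each set counted here has weight at least `x ^ (8 * s ^ 2) ≥ exp (-8 * s)`. -/
theorem card_filter_sum_excess_le {s : ℕ} (hs : 1 ≤ s) {n t : ℕ} (ht : t ≤ n) :
    ((univ : Finset (Finset (Fin n))).filter
      fun D => ∑ p ∈ (D : Finset (Fin n)), excess s t p ≤ 8 * s ^ 2).card ≤ 2 ^ (18 * s) := by
  set F := (univ : Finset (Finset (Fin n))).filter fun D => ∑ p ∈ (D : Finset (Fin n)), excess s t p ≤ 8 * s ^ 2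
  set x : ℝ := (s : ℝ) / (s + 1) with hx
  have hs' : (0 : ℝ) < s := by exact_mod_cast hs
  have hx0 : 0 < x := by positivity
  have hx1 : x ≤ 1 := by rw [hx, div_le_one (by positivity)]; linarith
  have h1 : (F.card : ℝ) * x ^ (8 * s ^ 2) ≤ Real.exp (4 * s) := by
    calc (F.card : ℝ) * x ^ (8 * s ^ 2) = ∑ D ∈ F, x ^ (8 * s ^ 2) := by simp
      _ ≤ ∑ D ∈ F, ∏ p ∈ D, x ^ excess s t p := by
          refine sum_le_sum fun D hD => ?_
          rw [prod_pow_eq_pow_sum]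
          exact pow_le_pow_of_le_one hx0.le hx1 (mem_filter.1 hD).2
      _ ≤ ∑ D : Finset (Fin n), ∏ p ∈ D, x ^ excess s t p :=
          sum_le_sum_of_subset_of_nonneg (subset_univ _) fun _ _ _ =>
            prod_nonneg fun _ _ => by positivity
      _ = ∏ p : Fin n, (1 + x ^ excess s t p) := by
          rw [prod_one_add, powerset_univ]
      _ ≤ ∏ p : Fin n, Real.exp (x ^ excess s t p) := by
          refine prod_le_prod (fun _ _ => by positivity) fun p _ => ?_
          rw [add_comm]; exact Real.add_one_le_exp _
      _ = Real.exp (∑ p : Fin n, x ^ excess s t p) := (Real.exp_sum _ _).symm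
      _ ≤ Real.exp (4 * s) := Real.exp_le_exp.2 (sum_pow_excess_le hs ht)
  -- From `1 / x = 1 + 1 / s ≤ exp (1 / s)`, raised to the power `8 * s ^ 2`.
  have h2 : (1 : ℝ) ≤ x ^ (8 * s ^ 2) * Real.exp (8 * s) := by
    have : (1 : ℝ) ≤ x * Real.exp (1 / s) := by
      have h3 : 1 + 1 / (s : ℝ) ≤ Real.exp (1 / s) := by
        rw [add_comm]; exact Real.add_one_le_exp _
      have h4 : x * (1 + 1 / (s : ℝ)) = 1 := by rw [hx]; field_simp
      calc (1 : ℝ) = x * (1 + 1 / (s : ℝ)) := h4.symm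
        _ ≤ _ := by gcongr
    calc (1 : ℝ) ≤ (x * Real.exp (1 / s)) ^ (8 * s ^ 2) := one_le_pow₀ this
      _ = _ := by
        rw [mul_pow, ← Real.exp_nat_mul]
        congr 2
        push_cast
        field_simp
  have h3 : (F.card : ℝ) ≤ Real.exp (12 * s) := by
    calc (F.card : ℝ) ≤ F.card * (x ^ (8 * s ^ 2) * Real.exp (8 * s)) :=
          le_mul_of_one_le_right (Nat.cast_nonneg _) h2
      _ = (F.card * x ^ (8 * s ^ 2)) * Real.exp (8 * s) := by ring
      _ ≤ Real.exp (4 * s) * Real.exp (8 * s) := by gcongr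
      _ = _ := by rw [← Real.exp_add]; ring_nf
  have h4 : Real.exp 2 ≤ 8 := by
    have := Real.exp_one_lt_d9
    have h5 : Real.exp 2 = Real.exp 1 * Real.exp 1 := by rw [← Real.exp_add]; norm_num
    rw [h5]
    nlinarith [Real.exp_pos 1]
  have h5 : (F.card : ℝ) ≤ ((2 ^ (18 * s) : ℕ) : ℝ) := by
    refine h3.trans ?_
    calc Real.exp (12 * s) = Real.exp 2 ^ (6 * s) := by
          rw [← Real.exp_nat_mul]; congr 1; push_cast; ring
      _ ≤ 8 ^ (6 * s) := by gcongr
      _ = _ := by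
        push_cast
        rw [show (8 : ℝ) = 2 ^ 3 by norm_num, ← pow_mul]; ring_nf
  exact_mod_cast h5

/-- There are `n + 1` choices for the cardinality `t` of `Z`; given `t`, the set `Z` is determined
by its symmetric difference with the first `t` positions. -/
theorem card_filter_farInversions_le {s : ℕ} (hs : 1 ≤ s) (n : ℕ) :
    ((univ : Finset (Finset (Fin n))).filter
      fun Z => (farInversions s Z).card ≤ 4 * s ^ 2).card ≤ (n + 1) * 2 ^ (18 * s) := by
  classical
  rw [card_eq_sum_card_fiberwise (f := card) (t := range (n + 1)) (by
    intro Z _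
    have := card_le_univ Z
    simp only [Fintype.card_fin] at this
    simp only [coe_range, Set.mem_Iio]
    omega)]
  calc _ ≤ ∑ t ∈ range (n + 1), 2 ^ (18 * s) := by
        refine sum_le_sum fun t ht => ?_
        refine le_trans ?_ (card_filter_sum_excess_le hs (Nat.lt_succ_iff.1 (mem_range.1 ht)))
        refine card_le_card_of_injOn
          (fun Z : Finset (Fin n) => univ.filter (fun p : Fin n => ¬ (p ∈ Z ↔ (p : ℕ) < t))) ?_ ?_
        · intro Z hZ
          simp only [coe_filter, mem_filter, mem_univ, true_and, Set.mem_ofPred_eq] at hZ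
          simp only [coe_filter, mem_univ, true_and, Set.mem_ofPred_eq]
          obtain ⟨h1, rfl⟩ := hZ
          exact (sum_excess_le s Z).trans (by omega)
        · intro Z _ Z' _ h
          ext p
          have := Finset.ext_iff.1 h p
          simp only [mem_filter, mem_univ, true_and] at this
          tauto
    _ = _ := by simp

theorem card_filter_cutSize_le {n : ℕ} {T : Digraph (Fin n)} (hT : IsSemicomplete T) {k s : ℕ}
    (hs : 1 ≤ s) (hks : k ≤ s ^ 3) (h : ∃ σ : Fin n ≃ Fin n, cost T σ ≤ k) :
    ((univ : Finset (Finset (Fin n))).filter fun X => cutSize T X ≤ 3 * s ^ 2).card ≤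
      (n + 1) * 2 ^ (18 * s) := by
  obtain ⟨σ, hσ⟩ := h
  refine le_trans ?_ (card_filter_farInversions_le hs n)
  refine card_le_card_of_injOn (fun X => X.map σ.symm.toEmbedding) ?_
    fun _ _ _ _ h => map_injective _ h
  intro X hX
  simp only [coe_filter, mem_univ, true_and, Set.mem_ofPred_eq] at hX ⊢
  have := card_farInversions_le hT hks σ hσ X
  omega

end OLA


/-! ### Orderings as paths in the graph of cuts -/

namespace OLA

open Finset

/-- The cost of adding the vertices of a list one by one, the last one in the list first. -/
noncomputable def pathCost {n : ℕ} (T : Digraph (Fin n)) : List (Fin n) → ℕ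
  | [] => 0
  | v :: p => pathCost T p + cutSize T (v :: p).toFinset

/-- The set of the vertices of a list, coded in binary. -/
def pathWeight {n : ℕ} : List (Fin n) → ℕ
  | [] => 0
  | v :: p => pathWeight p + 2 ^ (v : ℕ)

/-- A common code for the set of the vertices of a list and for its cost. -/
noncomputable def pathKey {n : ℕ} (T : Digraph (Fin n)) (k : ℕ) (p : List (Fin n)) : ℕ :=
  pathCost T p + (k + 1) * pathWeight p

/-- A list of distinct vertices of cost at most `k` that passes only through cuts of size at most
`R`. -/
inductive Valid {n : ℕ} (T : Digraph (Fin n)) (R k : ℕ) : List (Fin n) → Prop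
  | nil : Valid T R k []
  | cons {v : Fin n} {p : List (Fin n)} : Valid T R k p → v ∉ p →
      cutSize T (v :: p).toFinset ≤ R → pathCost T (v :: p) ≤ k → Valid T R k (v :: p)

variable {n : ℕ} {T : Digraph (Fin n)} {R k : ℕ}

theorem Valid.nodup {p : List (Fin n)} (h : Valid T R k p) : p.Nodup := by
  induction h with
  | nil => exact List.nodup_nil
  | cons _ hv _ _ ih => exact List.nodup_cons.2 ⟨hv, ih⟩

theorem Valid.pathCost_le {p : List (Fin n)} (h : Valid T R k p) : pathCost T p ≤ k := by
  cases h with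
  | nil => exact Nat.zero_le _
  | cons _ _ _ h => exact h

theorem cutSize_empty : cutSize T ∅ = 0 := by simp [cutSize]

theorem Valid.cutSize_le {p : List (Fin n)} (h : Valid T R k p) : cutSize T p.toFinset ≤ R := by
  cases h with
  | nil => simp [cutSize_empty]
  | cons _ _ h _ => exact h

theorem pathWeight_eq {p : List (Fin n)} (h : p.Nodup) :
    pathWeight p = ∑ i ∈ p.toFinset.map Fin.valEmbedding, 2 ^ i := by
  induction p with
  | nil => simp [pathWeight]
  | cons v p ih =>
    rw [List.nodup_cons] at h
    rw [pathWeight, ih h.2, sum_map, sum_map, List.toFinset_cons, sum_insert (by simpa using h.1),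
      add_comm]
    rfl

/-- The cost is the remainder of the key modulo `k + 1`, and the quotient determines the set by
uniqueness of binary expansions. -/
theorem eq_of_pathKey_eq {p q : List (Fin n)} (hp : Valid T R k p) (hq : Valid T R k q)
    (h : pathKey T k p = pathKey T k q) :
    pathCost T p = pathCost T q ∧ p.toFinset = q.toFinset := by
  have h1 := hp.pathCost_le
  have h2 := hq.pathCost_le
  unfold pathKey at h
  have h3 : pathCost T p = pathCost T q := by
    have := congrArg (· % (k + 1)) h
    simpa [Nat.add_mul_mod_self_left, Nat.mod_eq_of_lt (Nat.lt_succ_of_le h1),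
      Nat.mod_eq_of_lt (Nat.lt_succ_of_le h2)] using this
  refine ⟨h3, ?_⟩
  have h4 : pathWeight p = pathWeight q := by
    rw [h3] at h
    exact Nat.eq_of_mul_eq_mul_left (Nat.succ_pos k) (Nat.add_left_cancel h)
  rw [pathWeight_eq hp.nodup, pathWeight_eq hq.nodup] at h4
  exact map_injective _ (Finset.geomSum_injective le_rfl h4)

/-- The key changes by a tabulated weight and the new cut size, so the machine updates it by
additions alone. -/
theorem pathKey_cons (v : Fin n) (p : List (Fin n)) :
    pathKey T k (v :: p) =
      pathKey T k p + (k + 1) * 2 ^ (v : ℕ) + cutSize T (v :: p).toFinset := by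
  simp only [pathKey, pathCost, pathWeight]
  ring

/-- The future of a path depends only on its set and its cost. Hence the search loses nothing by
keeping one path per key. -/
theorem Valid.cons_congr {p q : List (Fin n)} {v : Fin n} (hq : Valid T R k q)
    (hvp : Valid T R k (v :: p)) (h : pathKey T k p = pathKey T k q) :
    Valid T R k (v :: q) ∧ pathKey T k (v :: p) = pathKey T k (v :: q) := by
  cases hvp with
  | cons hp hv hR hk =>
    obtain ⟨h1, h2⟩ := eq_of_pathKey_eq hp hq h
    refine ⟨.cons hq ?_ ?_ ?_, ?_⟩
    · rwa [← List.mem_toFinset, ← h2, List.mem_toFinset]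
    · rwa [List.toFinset_cons, ← h2, ← List.toFinset_cons]
    · rwa [pathCost, ← h1, List.toFinset_cons, ← h2, ← List.toFinset_cons]
    · rw [pathKey_cons, pathKey_cons, h, List.toFinset_cons, List.toFinset_cons, h2]

/-- The path that adds the first `t` vertices of an ordering. -/
def initialPath (σ : Fin n ≃ Fin n) : ℕ → List (Fin n)
  | 0 => []
  | t + 1 => if h : t < n then σ ⟨t, h⟩ :: initialPath σ t else initialPath σ t

theorem toFinset_initialPath (σ : Fin n ≃ Fin n) (t : ℕ) :
    (initialPath σ t).toFinset = initialSet σ t := by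
  induction t with
  | zero => simp [initialPath, initialSet]
  | succ t ih =>
    rw [initialPath]
    split_ifs with h
    · ext v
      rw [List.toFinset_cons, ih, mem_insert, mem_initialSet, mem_initialSet, Nat.lt_succ_iff_lt_or_eq,
        or_comm, ← Equiv.symm_apply_eq, Fin.ext_iff]
    · rw [ih]
      ext v
      rw [mem_initialSet, mem_initialSet]
      omega

theorem pathCost_initialPath (σ : Fin n ≃ Fin n) {t : ℕ} (ht : t ≤ n) :
    pathCost T (initialPath σ t) = ∑ u ∈ range t, cutSize T (initialSet σ (u + 1)) := by
  induction t with
  | zero => simp [initialPath, pathCost]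
  | succ t ih =>
    have h : initialPath σ (t + 1) = σ ⟨t, ht⟩ :: initialPath σ t := by
      rw [initialPath, dif_pos]
    rw [sum_range_succ, ← toFinset_initialPath, h, pathCost, ih (by omega)]

theorem pathCost_initialPath_card (σ : Fin n ≃ Fin n) : pathCost T (initialPath σ n) = cost T σ := by
  rw [pathCost_initialPath σ le_rfl, cost_eq_sum_cutSize]

theorem length_initialPath (σ : Fin n ≃ Fin n) {t : ℕ} (ht : t ≤ n) :
    (initialPath σ t).length = t := by
  induction t with
  | zero => rfl
  | succ t ih => rw [initialPath, dif_pos (by omega), List.length_cons, ih (by omega)]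

theorem valid_initialPath (σ : Fin n ≃ Fin n) (hR : ∀ t, cutSize T (initialSet σ t) ≤ R)
    (hk : cost T σ ≤ k) {t : ℕ} (ht : t ≤ n) : Valid T R k (initialPath σ t) := by
  induction t with
  | zero => exact .nil
  | succ t ih =>
    have h : initialPath σ (t + 1) = σ ⟨t, ht⟩ :: initialPath σ t := by
      rw [initialPath, dif_pos]
    rw [h]
    refine .cons (ih (by omega)) ?_ ?_ ?_
    · rw [← List.mem_toFinset, toFinset_initialPath, mem_initialSet]
      simp
    · rw [← h, toFinset_initialPath]; exact hR _
    · rw [← h, pathCost_initialPath σ ht]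
      refine le_trans ?_ hk
      rw [cost_eq_sum_cutSize]
      exact sum_le_sum_of_subset (range_mono ht)

/-- The head of a path is the vertex added last, so position `i` of the ordering is entry `n - 1 -
i` of the list. -/
theorem exists_equiv_of_nodup {p : List (Fin n)} (hp : p.Nodup) (hn : p.length = n) :
    ∃ σ : Fin n ≃ Fin n, initialPath σ n = p ∧
      ∀ i : Fin n, p[n - 1 - (i : ℕ)]? = some (σ i) := by
  have hlt : ∀ i : Fin n, n - 1 - (i : ℕ) < p.length := fun i => by omega
  have hinj : Function.Injective fun i : Fin n => p[n - 1 - (i : ℕ)]'(hlt i) := by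
    intro i j h
    have := (hp.getElem_inj_iff).1 h
    ext
    omega
  refine ⟨Equiv.ofBijective _ (Finite.injective_iff_bijective.1 hinj), ?_, fun i => ?_⟩
  · set σ := Equiv.ofBijective _ (Finite.injective_iff_bijective.1 hinj)
    have : ∀ t, t ≤ n → initialPath σ t = p.drop (n - t) := by
      intro t
      induction t with
      | zero => intro _; simp [initialPath, hn]
      | succ t ih =>
        intro ht
        rw [initialPath, dif_pos (by omega), ih (by omega),
          List.drop_eq_getElem_cons (i := n - (t + 1)) (by omega)]
        congr 1
        · simp only [σ, Equiv.ofBijective_apply]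
          congr 1
          omega
        · congr 1; omega
    simpa using this n le_rfl
  · simp only [Equiv.ofBijective_apply]
    exact List.getElem?_eq_getElem (hlt i)

/-! ### Lists of paths -/

/-- All paths in the list are valid and have different codes, and the list starts with the empty
path. -/
structure Explored (T : Digraph (Fin n)) (R k : ℕ) (L : List (List (Fin n))) : Prop where
  valid : ∀ p ∈ L, Valid T R k p
  nodup : (L.map (pathKey T k)).Nodup
  nil_mem : [] ∈ L

theorem Explored.singleton : Explored T R k [[]] where
  valid p hp := by rw [List.mem_singleton.1 hp]; exact .nil
  nodup := by simp
  nil_mem := by simp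

theorem Explored.append {L : List (List (Fin n))} (h : Explored T R k L) {p : List (Fin n)}
    (hp : Valid T R k p) (hL : pathKey T k p ∉ L.map (pathKey T k)) :
    Explored T R k (L ++ [p]) where
  valid q hq := by
    rcases List.mem_append.1 hq with hq | hq
    · exact h.valid q hq
    · rwa [List.mem_singleton.1 hq]
  nodup := by
    rw [List.map_append, List.map_singleton, List.nodup_append]
    refine ⟨h.nodup, by simp, ?_⟩
    rintro a ha b hb rfl
    rw [List.mem_singleton.1 hb] at ha
    exact hL ha
  nil_mem := List.mem_append_left _ h.nil_mem

/-- Every valid extension of `p` by one vertex is represented in the list. -/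
def ClosedAt (T : Digraph (Fin n)) (R k : ℕ) (L : List (List (Fin n))) (p : List (Fin n)) : Prop :=
  ∀ v, Valid T R k (v :: p) → pathKey T k (v :: p) ∈ L.map (pathKey T k)

/-- Completeness of an exhausted search, by induction along the path, replacing each prefix by the
representative with the same key. -/
theorem Explored.mem_of_valid {L : List (List (Fin n))} (h : Explored T R k L)
    (hc : ∀ p ∈ L, ClosedAt T R k L p) {p : List (Fin n)} (hp : Valid T R k p) :
    pathKey T k p ∈ L.map (pathKey T k) := by
  induction p with
  | nil => exact List.mem_map_of_mem h.nil_mem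
  | cons v p ih =>
    have hp' : Valid T R k p := by cases hp; assumption
    obtain ⟨q, hq, he⟩ := List.mem_map.1 (ih hp')
    obtain ⟨h1, h2⟩ := Valid.cons_congr (h.valid q hq) hp he.symm
    rw [h2]
    exact hc q hq v h1

theorem Explored.length_le {L : List (List (Fin n))} (h : Explored T R k L) :
    L.length ≤ ((univ : Finset (Finset (Fin n))).filter fun X => cutSize T X ≤ R).card * (k + 1) := by
  have h1 : (L.map fun p => (p.toFinset, pathCost T p)).Nodup := by
    rw [List.nodup_map_iff_inj_on (List.Nodup.of_map _ h.nodup)]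
    intro p hp q hq he
    refine List.inj_on_of_nodup_map h.nodup hp hq ?_
    have h2 := h.valid p hp
    have h3 := h.valid q hq
    simp only [Prod.mk.injEq] at he
    unfold pathKey
    rw [he.2, pathWeight_eq h2.nodup, pathWeight_eq h3.nodup, he.1]
  rw [← List.length_map (fun p => (p.toFinset, pathCost T p)), ← List.toFinset_card_of_nodup h1,
    ← card_range (k + 1), ← card_product]
  refine card_le_card fun x hx => ?_
  rw [List.mem_toFinset, List.mem_map] at hx
  obtain ⟨p, hp, rfl⟩ := hx
  have h2 := h.valid p hp
  simp only [mem_product, mem_filter, mem_univ, true_and, mem_range]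
  exact ⟨h2.cutSize_le, Nat.lt_succ_of_le h2.pathCost_le⟩

/-- This is the budget of the search: `18 * s` bits for the cut and `4 * s` for the cost, as `k + 1
≤ 2 ^ (4 * s)`. -/
theorem Explored.length_le_of_exists {L : List (List (Fin n))} {s : ℕ}
    (h : Explored T (3 * s ^ 2) k L) (hT : IsSemicomplete T) (hs : 1 ≤ s) (hks : k ≤ s ^ 3)
    (hσ : ∃ σ : Fin n ≃ Fin n, cost T σ ≤ k) : L.length ≤ (n + 1) * 2 ^ (22 * s) := by
  refine h.length_le.trans ?_
  have h1 : k + 1 ≤ 2 ^ (4 * s) := by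
    have h2 : s ^ 3 < (2 ^ s) ^ 3 := Nat.pow_lt_pow_left Nat.lt_two_pow_self (by norm_num)
    calc k + 1 ≤ (2 ^ s) ^ 3 := by omega
      _ = 2 ^ (3 * s) := by rw [← pow_mul, mul_comm]
      _ ≤ 2 ^ (4 * s) := Nat.pow_le_pow_right (by norm_num) (by omega)
  calc _ ≤ (n + 1) * 2 ^ (18 * s) * 2 ^ (4 * s) :=
        Nat.mul_le_mul (card_filter_cutSize_le hT hs hks hσ) h1
    _ = _ := by rw [mul_assoc, ← pow_add]; congr 2; omega

theorem Explored.exists_length_eq {L : List (List (Fin n))} {s : ℕ}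
    (h : Explored T (3 * s ^ 2) k L) (hc : ∀ p ∈ L, ClosedAt T (3 * s ^ 2) k L p)
    (hks : k ≤ s ^ 3) (hσ : ∃ σ : Fin n ≃ Fin n, cost T σ ≤ k) : ∃ p ∈ L, p.length = n := by
  obtain ⟨σ, hσ⟩ := hσ
  have hv := valid_initialPath σ (cutSize_initialSet_le T hks σ hσ) hσ le_rfl
  obtain ⟨p, hp, he⟩ := List.mem_map.1 (h.mem_of_valid hc hv)
  refine ⟨p, hp, ?_⟩
  have hpv := h.valid p hp
  rw [← List.toFinset_card_of_nodup hpv.nodup, (eq_of_pathKey_eq hpv hv he).2,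
    List.toFinset_card_of_nodup hv.nodup, length_initialPath σ le_rfl]

end OLA


/-! ### Reasoning about programs -/

namespace RAM

@[simp] theorem State.reg_setReg (s : State) (x v y : ℕ) :
    (s.setReg x v).reg y = if y = x then v else s.reg y := by
  simp [State.setReg, Function.update_apply]

@[simp] theorem State.mem_setReg (s : State) (x v : ℕ) : (s.setReg x v).mem = s.mem := rfl

@[simp] theorem State.reg_setMem (s : State) (a v : ℕ) : (s.setMem a v).reg = s.reg := rfl

@[simp] theorem State.mem_setMem (s : State) (a v : ℕ) :
    (s.setMem a v).mem = Function.update s.mem a v := rfl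

/-- Started in `s`, the program halts after at most `t` steps in a state with property `Q`. -/
def Halts (p : Prog) (s : State) (t : ℕ) (Q : State → Prop) : Prop :=
  ∃ s' t', Runs p s s' t' ∧ t' ≤ t ∧ Q s'

/-- The registers that a program may write. -/
def Prog.writes : Prog → ℕ → Bool
  | .skip, _ => false
  | .const x _, y => x == y
  | .add x _ _, y => x == y
  | .sub x _ _, y => x == y
  | .load x _, y => x == y
  | .store _ _, _ => false
  | .seq p q, y => p.writes y || q.writes y
  | .cond _ p q, y => p.writes y || q.writes y
  | .loop _ p, y => p.writes y

/-- The program may write into the memory. -/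
def Prog.stores : Prog → Bool
  | .store _ _ => true
  | .seq p q => p.stores || q.stores
  | .cond _ p q => p.stores || q.stores
  | .loop _ p => p.stores
  | _ => false

/-- The program has no loops. -/
def Prog.loopFree : Prog → Bool
  | .seq p q => p.loopFree && q.loopFree
  | .cond _ p q => p.loopFree && q.loopFree
  | .loop _ _ => false
  | _ => true

/-- A bound for the number of steps of a program without loops. -/
def Prog.size : Prog → ℕ
  | .seq p q => p.size + q.size
  | .cond _ p q => p.size + q.size + 1
  | _ => 1

/-- The final state of a program without loops. -/
def exec : Prog → State → State
  | .skip, s => s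
  | .const x c, s => s.setReg x c
  | .add x y z, s => s.setReg x (s.reg y + s.reg z)
  | .sub x y z, s => s.setReg x (s.reg y - s.reg z)
  | .load x y, s => s.setReg x (s.mem (s.reg y))
  | .store x y, s => s.setMem (s.reg x) (s.reg y)
  | .seq p q, s => exec q (exec p s)
  | .cond x p q, s => if s.reg x ≠ 0 then exec p s else exec q s
  | .loop _ _, s => s

/-- What a program leaves unchanged, judging from its text. -/
structure Frame (p : Prog) (s s' : State) : Prop where
  reg : ∀ x, p.writes x = false → s'.reg x = s.reg x
  mem : p.stores = false → s'.mem = s.mem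

theorem Frame.refl (p : Prog) (s : State) : Frame p s s := ⟨fun _ _ => rfl, fun _ => rfl⟩

theorem Frame.trans {p : Prog} {s s' s'' : State} (h : Frame p s s') (h' : Frame p s' s'') :
    Frame p s s'' :=
  ⟨fun x hx => (h'.reg x hx).trans (h.reg x hx), fun hp => (h'.mem hp).trans (h.mem hp)⟩

theorem Runs.frame {p : Prog} {s s' : State} {t : ℕ} (h : Runs p s s' t) : Frame p s s' := by
  induction h with
  | skip | loop_exit => exact Frame.refl _ _
  | const | add | sub | load =>
    refine ⟨fun y hy => ?_, fun _ => rfl⟩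
    simp only [Prog.writes, beq_eq_false_iff_ne] at hy
    simp [Ne.symm hy]
  | store => exact ⟨fun _ _ => rfl, fun h => by simp [Prog.stores] at h⟩
  | seq _ _ ih ih' =>
    refine ⟨fun y hy => ?_, fun hp => ?_⟩
    · simp only [Prog.writes, Bool.or_eq_false_iff] at hy
      exact (ih'.reg y hy.2).trans (ih.reg y hy.1)
    · simp only [Prog.stores, Bool.or_eq_false_iff] at hp
      exact (ih'.mem hp.2).trans (ih.mem hp.1)
  | cond_then _ _ ih =>
    refine ⟨fun y hy => ?_, fun hp => ?_⟩
    · simp only [Prog.writes, Bool.or_eq_false_iff] at hy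
      exact ih.reg y hy.1
    · simp only [Prog.stores, Bool.or_eq_false_iff] at hp
      exact ih.mem hp.1
  | cond_else _ _ ih =>
    refine ⟨fun y hy => ?_, fun hp => ?_⟩
    · simp only [Prog.writes, Bool.or_eq_false_iff] at hy
      exact ih.reg y hy.2
    · simp only [Prog.stores, Bool.or_eq_false_iff] at hp
      exact ih.mem hp.2
  | loop_iter _ _ _ ih ih' =>
    exact Frame.trans ⟨fun y hy => ih.reg y hy, fun hp => ih.mem hp⟩ ih'

namespace Halts

variable {p q : Prog} {s : State} {t t' : ℕ} {Q Q' : State → Prop}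

/-- The frame is supplied automatically here and in `seq`, so postconditions need not list untouched
registers. -/
theorem mono (h : Halts p s t Q) (hQ : ∀ s', Q s' → Frame p s s' → Q' s') (ht : t ≤ t') :
    Halts p s t' Q' := by
  obtain ⟨s', u, h1, h2, h3⟩ := h
  exact ⟨s', u, h1, h2.trans ht, hQ s' h3 h1.frame⟩

theorem seq (h : Halts p s t Q) (h' : ∀ s', Q s' → Frame p s s' → Halts q s' t' Q') :
    Halts (.seq p q) s (t + t') Q' := by
  obtain ⟨s', u, h1, h2, h3⟩ := h
  obtain ⟨s'', u', h1', h2', h3'⟩ := h' s' h3 h1.frame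
  exact ⟨s'', u + u', .seq h1 h1', by omega, h3'⟩

theorem cond {x : ℕ} (h : s.reg x ≠ 0 → Halts p s t Q) (h' : s.reg x = 0 → Halts q s t Q) :
    Halts (.cond x p q) s (t + 1) Q := by
  by_cases hx : s.reg x = 0
  · obtain ⟨s', u, h1, h2, h3⟩ := h' hx
    exact ⟨s', u + 1, .cond_else hx h1, by omega, h3⟩
  · obtain ⟨s', u, h1, h2, h3⟩ := h hx
    exact ⟨s', u + 1, .cond_then hx h1, by omega, h3⟩

theorem of_loopFree (hp : p.loopFree = true) (hQ : Q (exec p s)) : Halts p s p.size Q := by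
  suffices ∀ p : Prog, p.loopFree = true → ∀ s, ∃ t, Runs p s (exec p s) t ∧ t ≤ p.size by
    obtain ⟨t, h1, h2⟩ := this p hp s
    exact ⟨_, t, h1, h2, hQ⟩
  intro p
  induction p with
  | skip => exact fun _ s => ⟨1, .skip s, le_rfl⟩
  | const x c => exact fun _ s => ⟨1, .const s x c, le_rfl⟩
  | add x y z => exact fun _ s => ⟨1, .add s x y z, le_rfl⟩
  | sub x y z => exact fun _ s => ⟨1, .sub s x y z, le_rfl⟩
  | load x y => exact fun _ s => ⟨1, .load s x y, le_rfl⟩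
  | store x y => exact fun _ s => ⟨1, .store s x y, le_rfl⟩
  | seq p q ihp ihq =>
    intro h s
    simp only [Prog.loopFree, Bool.and_eq_true] at h
    obtain ⟨t, h1, h2⟩ := ihp h.1 s
    obtain ⟨t', h1', h2'⟩ := ihq h.2 (exec p s)
    exact ⟨_, .seq h1 h1', by simp only [Prog.size]; omega⟩
  | cond x p q ihp ihq =>
    intro h s
    simp only [Prog.loopFree, Bool.and_eq_true] at h
    by_cases hx : s.reg x = 0
    · obtain ⟨t', h1', h2'⟩ := ihq h.2 s
      refine ⟨t' + 1, ?_, by simp only [Prog.size]; omega⟩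
      rw [exec, if_neg (by simpa using hx)]
      exact .cond_else hx h1'
    · obtain ⟨t', h1', h2'⟩ := ihp h.1 s
      refine ⟨t' + 1, ?_, by simp only [Prog.size]; omega⟩
      rw [exec, if_pos hx]
      exact .cond_then hx h1'
  | loop => intro h; simp [Prog.loopFree] at h

theorem straight (hp : p.loopFree = true) (ht : p.size ≤ t) (hQ : Q (exec p s)) :
    Halts p s t Q :=
  (of_loopFree hp hQ).mono (fun _ h _ => h) ht

/-- The index `i` counts completed rounds. The bound `B` on their number comes from the invariant: a
passed test must imply `i < B`. -/
theorem loop {x B : ℕ} (I : ℕ → State → Prop) (h0 : I 0 s)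
    (step : ∀ i s', I i s' → Frame (.loop x p) s s' → s'.reg x ≠ 0 →
      i < B ∧ Halts p s' t (I (i + 1))) :
    Halts (.loop x p) s (B * (t + 1) + 1) (fun s' => s'.reg x = 0 ∧ ∃ i, I i s') := by
  suffices ∀ m i s', m + i = B → I i s' → Frame (.loop x p) s s' →
      Halts (.loop x p) s' (m * (t + 1) + 1) (fun s' => s'.reg x = 0 ∧ ∃ i, I i s') from
    this B 0 s rfl h0 (Frame.refl _ _)
  intro m
  induction m with
  | zero =>
    intro i s' hi hI hf
    by_cases hx : s'.reg x = 0
    · exact ⟨s', 1, .loop_exit hx, by omega, hx, i, hI⟩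
    · have := (step i s' hI hf hx).1
      omega
  | succ m ih =>
    intro i s' hi hI hf
    by_cases hx : s'.reg x = 0
    · exact ⟨s', 1, .loop_exit hx, by omega, hx, i, hI⟩
    · obtain ⟨s'', u, h1, h2, h3⟩ := (step i s' hI hf hx).2
      have hf' : Frame (.loop x p) s' s'' := ⟨h1.frame.reg, h1.frame.mem⟩
      obtain ⟨s₃, u', h1', h2', h3'⟩ := ih (i + 1) s'' (by omega) h3 (hf.trans hf')
      refine ⟨s₃, u + u' + 1, .loop_iter hx h1 h1', ?_, h3'⟩
      rw [Nat.succ_mul]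
      omega

end Halts

/-- Sequences of programs. -/
def block : List Prog → Prog
  | [] => .skip
  | p :: l => .seq p (block l)

/-- `for v := 0, …, b - 1 do p`, with an auxiliary register `c`. -/
def forLt (v c b : ℕ) (p : Prog) : Prog :=
  .seq (.const v 0) (.seq (.sub c b v) (.loop c (.seq p (.seq (.add v v 2) (.sub c b v)))))

theorem Halts.forLt {v c b m t : ℕ} {p : Prog} {s : State} (I : ℕ → State → Prop)
    (hreg : (v != c && v != b && c != b && v != 2 && c != 2 && !p.writes v && !p.writes b &&
      !p.writes 2) = true)
    (hb : s.reg b = m) (h2 : s.reg 2 = 1)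
    (hI : ∀ i s w x, I i s → I i ((s.setReg v w).setReg c x)) (h0 : I 0 s)
    (step : ∀ i < m, ∀ s', I i s' → s'.reg v = i → Frame (forLt v c b p) s s' →
      Halts p s' t (I (i + 1))) :
    Halts (forLt v c b p) s (m * (t + 3) + 3) (I m) := by
  simp only [Bool.and_eq_true, bne_iff_ne, ne_eq, Bool.not_eq_true'] at hreg
  obtain ⟨⟨⟨⟨⟨⟨⟨hvc, hvb⟩, hcb⟩, hv2⟩, hc2⟩, hpv⟩, hpb⟩, hp2⟩ := hreg
  have hwv : (RAM.forLt v c b p).writes b = false := by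
    simp [RAM.forLt, Prog.writes, hpb, hvb, hcb]
  have hw2 : (RAM.forLt v c b p).writes 2 = false := by
    simp [RAM.forLt, Prog.writes, hp2, hv2, hc2]
  have key : Halts (.loop c (.seq p (.seq (.add v v 2) (.sub c b v))))
      ((s.setReg v 0).setReg c m) (m * ((t + 2) + 1) + 1)
      (fun s' => s'.reg c = 0 ∧ ∃ i, I i s' ∧ s'.reg v = i ∧ s'.reg c = m - i ∧ i ≤ m ∧
        Frame (RAM.forLt v c b p) s s') := by
    refine Halts.loop (fun i s' => I i s' ∧ s'.reg v = i ∧ s'.reg c = m - i ∧ i ≤ m ∧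
        Frame (RAM.forLt v c b p) s s') ?_ ?_
    · refine ⟨hI _ _ _ _ h0, by simp [hvc], by simp, Nat.zero_le _, fun x hx => ?_, fun _ => rfl⟩
      simp only [RAM.forLt, Prog.writes, Bool.or_eq_false_iff, beq_eq_false_iff_ne] at hx
      simp [Ne.symm hx.1, Ne.symm hx.2.1]
    · rintro i s' ⟨h1, h3, h4, h5, h6⟩ - hc
      have him : i < m := by omega
      refine ⟨him, (step i him s' h1 h3 h6).seq fun s₁ h7 h8 => ?_⟩
      have e1 : s₁.reg v = i := (h8.reg v hpv).trans h3
      have e2 : s₁.reg 2 = 1 := ((h8.reg 2 hp2).trans (h6.reg 2 hw2)).trans h2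
      have e3 : s₁.reg b = m := ((h8.reg b hpb).trans (h6.reg b hwv)).trans hb
      refine (of_loopFree (p := .seq (.add v v 2) (.sub c b v)) rfl ?_)
      simp only [exec, e1, e2, State.reg_setReg, Ne.symm hvb, if_false, if_true, e3]
      refine ⟨hI _ _ _ _ h7, by simp [hvc], by simp, him, ?_⟩
      refine h6.trans ⟨fun x hx => ?_, fun hs => ?_⟩
      · simp only [RAM.forLt, Prog.writes, Bool.or_eq_false_iff, beq_eq_false_iff_ne] at hx
        simp [Ne.symm hx.1, Ne.symm hx.2.1, h8.reg x hx.2.2.1]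
      · simp only [RAM.forLt, Prog.stores, Bool.or_eq_false_iff] at hs
        simp [h8.mem hs.2.2.1]
  obtain ⟨s', u, r1, r2, r3, i, r4, -, r5, r6, -⟩ := key
  refine ⟨s', 1 + (1 + u), .seq (.const _ _ _) (.seq (.sub _ _ _ _) ?_), by
    have : t + 2 + 1 = t + 3 := rfl
    rw [this] at r2; omega, ?_⟩
  · simpa [Ne.symm hvb, hb] using r1
  · have : i = m := by omega
    rwa [← this]

/-- Doubles register `x` altogether `m` times. -/
def double (x : ℕ) : ℕ → Prog
  | 0 => .skip
  | m + 1 => .seq (.add x x x) (double x m)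

theorem exec_double (x m : ℕ) (s : State) :
    (exec (double x m) s).mem = s.mem ∧
      ∀ y, (exec (double x m) s).reg y = if y = x then s.reg x * 2 ^ m else s.reg y := by
  induction m generalizing s with
  | zero => simp +contextual [double, exec]
  | succ m ih =>
    simp only [double, exec]
    obtain ⟨h1, h2⟩ := ih (s.setReg x (s.reg x + s.reg x))
    refine ⟨h1, fun y => ?_⟩
    rw [h2]
    simp only [State.reg_setReg, if_true]
    split_ifs
    · ring
    · rfl

/-- Entry `i` of the array number `q < 8`; the arrays are interleaved and start at address
`n * n`. -/
def arr (n : ℕ) (m : ℕ → ℕ) (q i : ℕ) : ℕ := m (n * n + 8 * i + q)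

theorem arr_update {n : ℕ} {m : ℕ → ℕ} {q i a q' i' : ℕ} (hq : q < 8) (hq' : q' < 8) :
    arr n (Function.update m (n * n + 8 * i + q) a) q' i' =
      if q' = q ∧ i' = i then a else arr n m q' i' := by
  unfold arr
  rw [Function.update_apply]
  congr 1
  simp only [eq_iff_iff]
  omega

/-- Computes the address of entry `y` of array `q` in register `50`. -/
def address (q y : ℕ) : Prog :=
  block [.add 50 y y, .add 50 50 50, .add 50 50 50, .add 50 50 3, .const 51 q, .add 50 50 51]

/-- `x := arr q y` -/
def ld (q x y : ℕ) : Prog := .seq (address q y) (.load x 50)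

/-- `arr q x := y` -/
def st (q x y : ℕ) : Prog := .seq (address q x) (.store 50 y)

theorem exec_address (q y : ℕ) (s : State) :
    (exec (address q y) s).mem = s.mem ∧ ∀ z, (exec (address q y) s).reg z =
      if z = 50 then s.reg 3 + 8 * s.reg y + q else if z = 51 then q else s.reg z := by
  refine ⟨rfl, fun z => ?_⟩
  simp only [address, block, exec, State.reg_setReg]
  by_cases h50 : z = 50
  · subst h50; simp; ring
  · by_cases h51 : z = 51 <;> simp [h50, h51]

theorem reg_exec_ld (q x y z : ℕ) (s : State) :
    (exec (ld q x y) s).reg z = if z = x then s.mem (s.reg 3 + 8 * s.reg y + q) else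
      if z = 50 then s.reg 3 + 8 * s.reg y + q else if z = 51 then q else s.reg z := by
  obtain ⟨h1, h2⟩ := exec_address q y s
  simp only [ld, exec, State.reg_setReg, h1, h2, if_true]

theorem mem_exec_ld (q x y : ℕ) (s : State) : (exec (ld q x y) s).mem = s.mem := by
  obtain ⟨h1, h2⟩ := exec_address q y s
  simp only [ld, exec, State.mem_setReg, h1]

theorem reg_exec_st (q x y z : ℕ) (s : State) :
    (exec (st q x y) s).reg z =
      if z = 50 then s.reg 3 + 8 * s.reg x + q else if z = 51 then q else s.reg z := by
  obtain ⟨h1, h2⟩ := exec_address q x s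
  simp only [st, exec, State.reg_setMem, h2]

theorem mem_exec_st {q x y : ℕ} (hy : y ≠ 50) (hy' : y ≠ 51) (s : State) :
    (exec (st q x y) s).mem = Function.update s.mem (s.reg 3 + 8 * s.reg x + q) (s.reg y) := by
  obtain ⟨h1, h2⟩ := exec_address q x s
  simp only [st, exec, State.mem_setMem, h1, h2, if_true, hy, hy', if_false]

end RAM


/-! ### The program -/

namespace OLA

open Finset RAM

/-- Register `24` receives the size of the cut given by the indicator array `1`. -/
def cutProg : Prog :=
  block [.const 24 0, .const 23 0,
    forLt 19 20 0 (block [ld 1 25 19,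
      .cond 25 .skip (forLt 21 22 0 (block [ld 1 25 21,
        .cond 25 (block [.add 26 23 21, .load 26 26, .add 24 24 26]) .skip])),
      .add 23 23 0])]

/-- The array `1` becomes the indicator of the path at the head of the queue, and register `14` its
length. -/
def decodeProg : Prog :=
  block [forLt 28 29 0 (block [.const 25 0, st 1 28 25]),
    block [.const 25 0, .add 13 11 25, ld 6 14 11],
    forLt 28 29 14 (block [ld 3 25 13, st 1 25 2, ld 2 13 13])]

/-- Appends a new path to the queue. -/
def pushProg : Prog :=
  block [st 2 10 11, st 3 10 17, st 4 10 30, st 5 10 31, .add 32 14 2, st 6 10 32, st 7 31 2,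
    .add 10 10 2]

/-- Register `26` becomes `0` if the extension of the path at the head of the queue by the vertex in
register `17` is valid and new. -/
def testProg : Prog :=
  block [.const 25 0, st 1 17 25, .sub 26 24 8, .add 30 15 24, .sub 27 30 1, .add 26 26 27,
    ld 0 31 17, .add 31 31 16, .add 31 31 24, ld 7 27 31, .add 26 26 27]

/-- Extends the path at the head of the queue by the vertex in register `17`. -/
def extendProg : Prog :=
  block [ld 1 25 17, .cond 25 .skip
    (block [st 1 17 2, cutProg, testProg, .cond 26 .skip pushProg])]

/-- Processes the path at the head of the queue. -/
def expandProg : Prog :=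
  block [block [ld 4 15 11, ld 5 16 11], forLt 17 18 0 extendProg, .add 11 11 2]

/-- Register `9` becomes `0` if the search is over. -/
def guardProg : Prog :=
  block [.add 26 7 2, .sub 26 26 10, .sub 9 10 11, .cond 26 .skip (.const 9 0),
    .cond 12 (.const 9 0) .skip]

/-- One step of the search. -/
def searchProg : Prog :=
  block [decodeProg, .sub 25 0 14, .cond 25 expandProg (.const 12 1), guardProg]

/-- Writes the ordering found into the memory. -/
def outputProg : Prog :=
  block [block [.const 25 0, .add 13 11 25, .add 33 0 25],
    forLt 28 29 0 (block [.sub 33 33 2, ld 3 25 13, .store 33 25, ld 2 13 13]), .const 0 1]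

/-- Computes the parameters of the search. -/
def parameterProg : Prog :=
  block [.const 2 1, .const 3 0, forLt 28 29 0 (.add 3 3 0),
    block [.const 4 1, .const 5 1, .const 6 1, .add 7 0 2, double 7 22, .sub 9 1 6],
    .loop 9 (block [.add 6 6 5, .add 6 6 5, .add 6 6 5, .add 6 6 4, .add 6 6 4, .add 6 6 4,
      .add 6 6 2, .add 5 5 4, .add 5 5 4, .add 5 5 2, .add 4 4 2, double 7 22, .sub 9 1 6]),
    block [.add 8 5 5, .add 8 8 5]]

/-- Initializes the arrays. -/
def arrayProg : Prog :=
  block [.add 25 1 2, forLt 28 29 0 (block [st 0 28 25, .add 25 25 25]),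
    block [st 7 10 2, .const 10 1]]

/-- The whole algorithm. -/
def orderingProg : Prog :=
  block [parameterProg, arrayProg, guardProg, .loop 9 searchProg, .cond 12 outputProg (.const 0 0)]

/-! ### Invariants -/

open Classical in
/-- The constants that the search uses are in place. -/
structure Base {n : ℕ} (T : Digraph (Fin n)) (R k P : ℕ) (s : State) : Prop where
  reg0 : s.reg 0 = n
  reg1 : s.reg 1 = k
  reg2 : s.reg 2 = 1
  reg3 : s.reg 3 = n * n
  reg7 : s.reg 7 = P
  reg8 : s.reg 8 = R
  matrix : ∀ i j : Fin n, s.mem ((i : ℕ) * n + j) = if T.Adj i j then 1 else 0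
  weight : ∀ i < n, arr n s.mem 0 i = (k + 1) * 2 ^ i

/-- The array `1` is the indicator of `X`. -/
def Indicates {n : ℕ} (m : ℕ → ℕ) (X : Finset (Fin n)) : Prop :=
  ∀ v : Fin n, arr n m 1 v = if v ∈ X then 1 else 0

/-- The arrays `2` to `7` represent a list of paths. -/
structure Table {n : ℕ} (T : Digraph (Fin n)) (k : ℕ) (m : ℕ → ℕ) (L : List (List (Fin n))) :
    Prop where
  link : ∀ (j : ℕ) (v : Fin n) (p : List (Fin n)), L[j]? = some (v :: p) → arr n m 3 j = v ∧ L[arr n m 2 j]? = some p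
  data : ∀ j p, L[j]? = some p →
    arr n m 4 j = pathCost T p ∧ arr n m 5 j = pathKey T k p ∧ arr n m 6 j = p.length
  seen : ∀ x, arr n m 7 x ≠ 0 ↔ x ∈ L.map (pathKey T k)

/-- The memory contents agree except possibly in the array `1`. -/
structure AgreeExceptIndicator (n : ℕ) (m m' : ℕ → ℕ) : Prop where
  low : ∀ a < n * n, m' a = m a
  arr : ∀ q < 8, q ≠ 1 → ∀ i, arr n m' q i = arr n m q i

variable {n : ℕ} {T : Digraph (Fin n)} {R k P : ℕ} {s s' : State} {L : List (List (Fin n))}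
  {m m' m'' : ℕ → ℕ}

theorem AgreeExceptIndicator.refl : AgreeExceptIndicator n m m :=
  ⟨fun _ _ => rfl, fun _ _ _ _ => rfl⟩

theorem AgreeExceptIndicator.trans (h : AgreeExceptIndicator n m m')
    (h' : AgreeExceptIndicator n m' m'') : AgreeExceptIndicator n m m'' :=
  ⟨fun a ha => (h'.low a ha).trans (h.low a ha),
    fun q hq hq' i => (h'.arr q hq hq' i).trans (h.arr q hq hq' i)⟩

theorem update_of_lt {a i q v : ℕ} (ha : a < n * n) :
    Function.update m (n * n + 8 * i + q) v a = m a :=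
  Function.update_of_ne (by omega) _ _

theorem AgreeExceptIndicator.update (i v : ℕ) :
    AgreeExceptIndicator n m (Function.update m (n * n + 8 * i + 1) v) :=
  ⟨fun _ ha => update_of_lt ha, fun q hq hq' i => by
    rw [arr_update (by norm_num) hq, if_neg (fun h => hq' h.1)]⟩

theorem Base.congr (h : Base T R k P s) (hr : ∀ x ∈ [0, 1, 2, 3, 7, 8], s'.reg x = s.reg x)
    (hm : ∀ a < n * n, s'.mem a = s.mem a) (hw : ∀ i, arr n s'.mem 0 i = arr n s.mem 0 i) :
    Base T R k P s' where
  reg0 := (hr 0 (by simp)).trans h.reg0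
  reg1 := (hr 1 (by simp)).trans h.reg1
  reg2 := (hr 2 (by simp)).trans h.reg2
  reg3 := (hr 3 (by simp)).trans h.reg3
  reg7 := (hr 7 (by simp)).trans h.reg7
  reg8 := (hr 8 (by simp)).trans h.reg8
  matrix i j := by
    rw [hm, h.matrix]
    have := i.2; have := j.2
    nlinarith
  weight i hi := (hw i).trans (h.weight i hi)

theorem Base.frame {p : Prog} (h : Base T R k P s) (hf : Frame p s s')
    (hr : ([0, 1, 2, 3, 7, 8].all fun x => !p.writes x) = true)
    (hm : AgreeExceptIndicator n s.mem s'.mem) : Base T R k P s' := by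
  refine h.congr (fun x hx => hf.reg x ?_) hm.low (hm.arr 0 (by norm_num) (by norm_num))
  have := List.all_eq_true.1 hr x hx
  simpa using this

theorem Base.frame_of_not_stores {p : Prog} (h : Base T R k P s) (hf : Frame p s s')
    (hr : ([0, 1, 2, 3, 7, 8].all fun x => !p.writes x) = true) (hp : p.stores = false) :
    Base T R k P s' :=
  h.frame hf hr (by rw [hf.mem hp]; exact .refl)

theorem Table.congr (h : Table T k m L) (hm : AgreeExceptIndicator n m m') : Table T k m' L where
  link j v p hj := by
    rw [hm.arr 3 (by norm_num) (by norm_num), hm.arr 2 (by norm_num) (by norm_num)]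
    exact h.link j v p hj
  data j p hj := by
    rw [hm.arr 4 (by norm_num) (by norm_num), hm.arr 5 (by norm_num) (by norm_num),
      hm.arr 6 (by norm_num) (by norm_num)]
    exact h.data j p hj
  seen x := by
    rw [hm.arr 7 (by norm_num) (by norm_num)]
    exact h.seen x

/-! ### Computing the size of a cut -/

open Classical in
theorem cutSize_eq_sum_range (X : Finset (Fin n)) (g : ℕ → ℕ → ℕ)
    (hg : ∀ y x : Fin n, g y x = if y ∉ X ∧ x ∈ X ∧ T.Adj y x then 1 else 0) :
    ∑ y ∈ range n, ∑ x ∈ range n, g y x = cutSize T X := by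
  simp_rw [Finset.sum_range, hg]
  rfl

/-- Register `23` follows the row offset `y * n` by repeated addition, as there is no
multiplication. -/
theorem halts_cutProg (hB : Base T R k P s) {X : Finset (Fin n)} (hX : Indicates s.mem X) :
    Halts cutProg s (n * (n * 20 + 30) + 30)
      (fun s' => s'.reg 24 = cutSize T X ∧ Frame cutProg s s') := by
  set g : ℕ → ℕ → ℕ := fun y x =>
    if arr n s.mem 1 y = 0 ∧ arr n s.mem 1 x ≠ 0 then s.mem (y * n + x) else 0 with hg
  have hcut : ∑ y ∈ range n, ∑ x ∈ range n, g y x = cutSize T X := by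
    refine cutSize_eq_sum_range X g fun y x => ?_
    simp only [hg, hX y, hX x, hB.matrix]
    by_cases hy : y ∈ X <;> by_cases hx : x ∈ X <;> by_cases hT : T.Adj y x <;> simp [hy, hx, hT]
  suffices h : Halts cutProg s (1 + (1 + (n * ((n * 20 + 27) + 3) + 3 + 1)))
      (fun s' => s'.reg 24 = cutSize T X) from
    h.mono (fun s' h hf => ⟨h, hf⟩) (by ring_nf; omega)
  refine Halts.seq (.straight (Q := fun s' => s'.reg 24 = 0) rfl le_rfl (by simp [exec]))
    fun s₁ h1 f1 => ?_
  refine Halts.seq (.straight (Q := fun s' => s'.reg 24 = 0 ∧ s'.reg 23 = 0) rfl le_rfl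
    (by simp [exec, h1])) fun s₂ h2 f2 => ?_
  have hB₂ := (hB.frame_of_not_stores f1 rfl rfl).frame_of_not_stores f2 rfl rfl
  have hm₂ : s₂.mem = s.mem := (f2.mem rfl).trans (f1.mem rfl)
  refine Halts.seq (Q := fun s' => s'.reg 24 = cutSize T X) ?_
    fun s₃ h3 _ => .straight rfl le_rfl h3
  refine (Halts.forLt (fun i s' => s'.reg 23 = i * n ∧
    s'.reg 24 = ∑ y ∈ range i, ∑ x ∈ range n, g y x) rfl hB₂.reg0 hB₂.reg2
    (by intro i s' w x h; simpa using h) (by simp [h2]) ?_).mono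
    (fun s' h _ => h.2.trans hcut) le_rfl
  intro i hi s₃ ⟨h3, h3'⟩ hv f3
  have hB₃ := hB₂.frame_of_not_stores f3 rfl rfl
  have hm₃ : s₃.mem = s.mem := (f3.mem rfl).trans hm₂
  suffices h : Halts (block [ld 1 25 19,
      .cond 25 .skip (forLt 21 22 0 (block [ld 1 25 21,
        .cond 25 (block [.add 26 23 21, .load 26 26, .add 24 24 26]) .skip])),
      .add 23 23 0]) s₃ (8 + ((n * (17 + 3) + 3 + 1) + (1 + 1))) _ from
    h.mono (fun _ h _ => h) (by omega)
  refine Halts.seq (.straight (Q := fun s' => s'.reg 25 = arr n s.mem 1 i) rfl (by decide)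
    (by simp [reg_exec_ld, hB₃.reg3, hm₃, hv, arr])) fun s₄ h4 f4 => ?_
  have hB₄ := hB₃.frame_of_not_stores f4 rfl rfl
  have hm₄ : s₄.mem = s.mem := (f4.mem rfl).trans hm₃
  have h23 : s₄.reg 23 = i * n := (f4.reg 23 rfl).trans h3
  have h24 : s₄.reg 24 = ∑ y ∈ range i, ∑ x ∈ range n, g y x := (f4.reg 24 rfl).trans h3'
  refine Halts.seq (Q := fun s' => s'.reg 24 = ∑ y ∈ range (i + 1), ∑ x ∈ range n, g y x) ?_ ?_
  · rw [sum_range_succ, ← h24]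
    refine Halts.cond (fun h => ?_) (fun h => ?_)
    · refine .straight rfl (by simp [Prog.size]) ?_
      rw [h4] at h
      simp [exec, hg, h]
    · rw [h4] at h
      refine (Halts.forLt (fun j s' => s'.reg 24 = s₄.reg 24 + ∑ x ∈ range j, g i x) rfl
        hB₄.reg0 hB₄.reg2 (by intro i s' w x h; simpa using h) (by simp) ?_).mono
        (fun s' h _ => h) le_rfl
      intro j hj s₅ h5 hv5 f5
      have hB₅ := hB₄.frame_of_not_stores f5 rfl rfl
      have hm₅ : s₅.mem = s.mem := (f5.mem rfl).trans hm₄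
      have h235 := (f5.reg 23 rfl).trans h23
      refine .straight rfl (by decide) ?_
      rw [sum_range_succ]
      have e1 : s.mem (n * n + 8 * j + 1) = arr n s.mem 1 j := rfl
      by_cases hj0 : arr n s.mem 1 j = 0
      · simp [exec, block, reg_exec_ld, hB₅.reg3, hm₅, hv5, e1, hg, h, hj0, h5]
      · simp [exec, block, reg_exec_ld, mem_exec_ld, hB₅.reg3, hm₅, hv5, e1, hg, h, hj0, h5, h235]
        ring
  · intro s₅ h5 f5
    refine .straight rfl (by decide) ?_
    have h235 : s₅.reg 23 = i * n := (f5.reg 23 rfl).trans h23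
    have h05 : s₅.reg 0 = n := (f5.reg 0 rfl).trans hB₄.reg0
    simp [exec, block, h5, h235, h05]
    ring

end OLA


namespace OLA

open Finset RAM

variable {n : ℕ} {T : Digraph (Fin n)} {R k P : ℕ} {s s' : State} {L : List (List (Fin n))}
  {m m' m'' : ℕ → ℕ}

/-! ### Decoding a path -/

/-- Paths are stored as parent links: array `3` holds the last vertex and array `2` the entry of the
remaining path, so following the links `p.length` times lists the set. -/
theorem halts_decodeProg (hB : Base T R k P s) (hL : Table T k s.mem L) {p : List (Fin n)}
    (hp : L[s.reg 11]? = some p) :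
    Halts decodeProg s (n * 13 + 3 + (11 + (p.length * 28 + 4)))
      (fun s' => Base T R k P s' ∧ AgreeExceptIndicator n s.mem s'.mem ∧
        Indicates s'.mem p.toFinset ∧ s'.reg 14 = p.length ∧ Frame decodeProg s s') := by
  suffices h : Halts decodeProg s (n * (10 + 3) + 3 + (11 + ((p.length * (25 + 3) + 3) + 1)))
      (fun s' => Base T R k P s' ∧ AgreeExceptIndicator n s.mem s'.mem ∧
        Indicates s'.mem p.toFinset ∧ s'.reg 14 = p.length) from
    h.mono (fun s' h hf => ⟨h.1, h.2.1, h.2.2.1, h.2.2.2, hf⟩) (by omega)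
  refine Halts.seq (Halts.forLt (fun i s' => Base T R k P s' ∧ AgreeExceptIndicator n s.mem s'.mem ∧
    ∀ j < i, arr n s'.mem 1 j = 0) rfl hB.reg0 hB.reg2 ?_ ⟨hB, .refl, by simp⟩ ?_) ?_
  · rintro i s' w x ⟨h1, h2, h3⟩
    exact ⟨h1.congr (by simp) (by simp) (by simp), h2, h3⟩
  · rintro i hi s₁ ⟨h1, h2, h3⟩ hv -
    refine (Halts.straight (Q := fun s' => s'.mem = Function.update s₁.mem (n * n + 8 * i + 1) 0)
      rfl (by decide) ?_).mono (fun s₂ h4 f2 => ?_) le_rfl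
    · simp [exec, block, mem_exec_st, h1.reg3, hv]
    · have h5 : AgreeExceptIndicator n s₁.mem s₂.mem := by rw [h4]; exact .update _ _
      refine ⟨h1.frame f2 rfl h5, h2.trans h5, fun j hj => ?_⟩
      rw [h4, arr_update (by norm_num) (by norm_num)]
      split_ifs with h
      · rfl
      · exact h3 j (by omega)
  rintro s₁ ⟨hB₁, hm₁, h0⟩ f1
  have h11 : s₁.reg 11 = s.reg 11 := f1.reg 11 rfl
  refine Halts.seq (Halts.straight (Q := fun s' => s'.reg 13 = s.reg 11 ∧ s'.reg 14 = p.length ∧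
    s'.mem = s₁.mem) rfl (by decide) ?_) ?_
  · have := ((hL.congr hm₁).data _ _ hp).2.2
    unfold arr at this
    simp [exec, block, reg_exec_ld, mem_exec_ld, hB₁.reg3, h11, this]
  rintro s₂ ⟨h13, h14, hm₂⟩ f2
  have hB₂ := hB₁.frame_of_not_stores f2 rfl rfl
  refine Halts.seq (Halts.forLt (fun i s' => Base T R k P s' ∧ AgreeExceptIndicator n s.mem s'.mem ∧
    Indicates s'.mem (p.take i).toFinset ∧ L[s'.reg 13]? = some (p.drop i)) rfl h14 hB₂.reg2 ?_
    ⟨hB₂, hm₂ ▸ hm₁, ?_, ?_⟩ ?_) ?_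
  · rintro i s' w x ⟨h1, h2, h3, h4⟩
    exact ⟨h1.congr (by simp) (by simp) (by simp), h2, h3, by simpa using h4⟩
  · intro v
    rw [hm₂, h0 v v.2]
    simp
  · rw [h13, hp, List.drop_zero]
  · rintro i hi s₃ ⟨hB₃, hm₃, h3, hd⟩ hv f3
    rw [List.drop_eq_getElem_cons hi] at hd
    obtain ⟨hl1, hl2⟩ := (hL.congr hm₃).link _ _ _ hd
    refine (Halts.straight (Q := fun s' =>
      s'.mem = Function.update s₃.mem (n * n + 8 * (p[i] : ℕ) + 1) 1 ∧
      s'.reg 13 = arr n s₃.mem 2 (s₃.reg 13)) rfl (by decide) ?_).mono (fun s₄ h4 f4 => ?_) le_rfl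
    · unfold arr at hl1 ⊢
      simp only [exec, block, reg_exec_ld, mem_exec_ld, reg_exec_st, hB₃.reg3, hB₃.reg2, hl1,
        mem_exec_st (show 2 ≠ 50 by norm_num) (show 2 ≠ 51 by norm_num)]
      refine ⟨by simp, ?_⟩
      simp only [Nat.reduceEqDiff, if_true, if_false]
      -- The write to array `1` and the read from array `2` have addresses with different residues
      -- modulo `8`, relative to `n * n`.
      rw [Function.update_of_ne (by omega)]
    · have h5 : AgreeExceptIndicator n s₃.mem s₄.mem := by rw [h4.1]; exact .update _ _
      refine ⟨hB₃.frame f4 rfl h5, hm₃.trans h5, fun v => ?_, by rw [h4.2, hl2]⟩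
      rw [h4.1, arr_update (by norm_num) (by norm_num), h3 v, List.take_succ_eq_append_getElem hi]
      simp only [true_and, List.toFinset_append, mem_union, List.mem_toFinset, List.mem_singleton,
        Fin.ext_iff]
      by_cases h6 : (v : ℕ) = p[i] <;> simp [h6]
  · rintro s₃ ⟨hB₃, hm₃, h3, -⟩ f3
    rw [List.take_length] at h3
    exact .straight rfl le_rfl ⟨hB₃, hm₃, h3, (f3.reg 14 rfl).trans h14⟩

/-! ### Extending a path -/

theorem Table.append (hL : Table T k m L) {j : ℕ} {v : Fin n} {p : List (Fin n)}
    (hp : L[j]? = some p)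
    (h2 : ∀ i, arr n m' 2 i = if i = L.length then j else arr n m 2 i)
    (h3 : ∀ i, arr n m' 3 i = if i = L.length then (v : ℕ) else arr n m 3 i)
    (h4 : ∀ i, arr n m' 4 i = if i = L.length then pathCost T (v :: p) else arr n m 4 i)
    (h5 : ∀ i, arr n m' 5 i = if i = L.length then pathKey T k (v :: p) else arr n m 5 i)
    (h6 : ∀ i, arr n m' 6 i = if i = L.length then p.length + 1 else arr n m 6 i)
    (h7 : ∀ i, arr n m' 7 i = if i = pathKey T k (v :: p) then 1 else arr n m 7 i) :
    Table T k m' (L ++ [v :: p]) := by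
  have hget : ∀ {i : ℕ} {q : List (Fin n)}, (L ++ [v :: p])[i]? = some q →
      (i = L.length ∧ q = v :: p) ∨ (i ≠ L.length ∧ L[i]? = some q) := by
    intro i q h
    rw [List.getElem?_append] at h
    split_ifs at h with hi
    · exact Or.inr ⟨by omega, h⟩
    · rw [List.getElem?_singleton] at h
      split_ifs at h with hi'
      exact Or.inl ⟨by omega, by simpa using h.symm⟩
  have hget' : ∀ {i : ℕ} {q : List (Fin n)}, L[i]? = some q → (L ++ [v :: p])[i]? = some q := by
    intro i q h
    rwa [List.getElem?_append_left (List.getElem?_eq_some_iff.1 h).1]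
  refine ⟨fun i w q h => ?_, fun i q h => ?_, fun x => ?_⟩
  · rw [h2, h3]
    rcases hget h with ⟨rfl, h'⟩ | ⟨hi, h⟩
    · obtain ⟨rfl, rfl⟩ := List.cons.inj h'
      simp [hget' hp]
    · rw [if_neg hi, if_neg hi]
      exact ⟨(hL.link i w q h).1, hget' (hL.link i w q h).2⟩
  · rw [h4, h5, h6]
    rcases hget h with ⟨rfl, rfl⟩ | ⟨hi, h⟩
    · simp
    · rw [if_neg hi, if_neg hi, if_neg hi]
      exact hL.data i q h
  · rw [h7, List.map_append, List.mem_append, ← hL.seen, List.map_singleton, List.mem_singleton]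
    split_ifs with h <;> simp [h]

/-- The state of the search while the path `p`, entry number `j`, is being extended. -/
structure Expanding (T : Digraph (Fin n)) (R k P j : ℕ) (p : List (Fin n))
    (L : List (List (Fin n))) (s : State) : Prop where
  base : Base T R k P s
  table : Table T k s.mem L
  explored : Explored T R k L
  indicates : Indicates s.mem p.toFinset
  entry : L[j]? = some p
  reg10 : s.reg 10 = L.length
  reg11 : s.reg 11 = j
  reg14 : s.reg 14 = p.length
  reg15 : s.reg 15 = pathCost T p
  reg16 : s.reg 16 = pathKey T k p

theorem Expanding.congr {j : ℕ} {p : List (Fin n)} (h : Expanding T R k P j p L s)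
    (hr : ∀ x ∈ [0, 1, 2, 3, 7, 8, 10, 11, 14, 15, 16], s'.reg x = s.reg x)
    (hm : AgreeExceptIndicator n s.mem s'.mem) (hX : Indicates s'.mem p.toFinset) :
    Expanding T R k P j p L s' where
  base := h.base.congr (fun x hx => hr x (by simp at hx ⊢; tauto)) hm.low
    (hm.arr 0 (by norm_num) (by norm_num))
  table := h.table.congr hm
  explored := h.explored
  indicates := hX
  entry := h.entry
  reg10 := (hr 10 (by simp)).trans h.reg10
  reg11 := (hr 11 (by simp)).trans h.reg11
  reg14 := (hr 14 (by simp)).trans h.reg14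
  reg15 := (hr 15 (by simp)).trans h.reg15
  reg16 := (hr 16 (by simp)).trans h.reg16

theorem Expanding.frame {j : ℕ} {p : List (Fin n)} {q : Prog} (h : Expanding T R k P j p L s)
    (hf : Frame q s s')
    (hr : ([0, 1, 2, 3, 7, 8, 10, 11, 14, 15, 16].all fun x => !q.writes x) = true)
    (hm : AgreeExceptIndicator n s.mem s'.mem) (hX : Indicates s'.mem p.toFinset) :
    Expanding T R k P j p L s' := by
  refine h.congr (fun x hx => hf.reg x ?_) hm hX
  have := List.all_eq_true.1 hr x hx
  simpa using this

theorem halts_pushProg {j : ℕ} {p : List (Fin n)} {v : Fin n} (h : Expanding T R k P j p L s)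
    (hv : s.reg 17 = v) (h30 : s.reg 30 = pathCost T (v :: p))
    (h31 : s.reg 31 = pathKey T k (v :: p)) (hp : Valid T R k (v :: p))
    (hn : pathKey T k (v :: p) ∉ L.map (pathKey T k)) :
    Halts pushProg s 60 (Expanding T R k P j p (L ++ [v :: p])) := by
  have hmem : (exec pushProg s).mem =
      Function.update (Function.update (Function.update (Function.update (Function.update
        (Function.update s.mem (n * n + 8 * L.length + 2) j) (n * n + 8 * L.length + 3) v)
        (n * n + 8 * L.length + 4) (pathCost T (v :: p)))
        (n * n + 8 * L.length + 5) (pathKey T k (v :: p)))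
        (n * n + 8 * L.length + 6) (p.length + 1))
        (n * n + 8 * pathKey T k (v :: p) + 7) 1 := by
    simp [pushProg, exec, block, mem_exec_st, reg_exec_st, h.base.reg3, h.base.reg2, h.reg10,
      h.reg11, h.reg14, hv, h30, h31]
  refine (Halts.straight (Q := fun s' => s'.mem = (exec pushProg s).mem ∧
    s'.reg 10 = L.length + 1) rfl (by decide) ⟨rfl, ?_⟩).mono (fun s' h1 f => ?_) le_rfl
  · simp [pushProg, exec, block, reg_exec_st, h.reg10, h.base.reg2]
  obtain ⟨hm, h10⟩ := h1
  rw [hmem] at hm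
  have hr : ∀ x ∈ [0, 1, 2, 3, 7, 8], s'.reg x = s.reg x := by
    intro x hx
    refine f.reg x ?_
    have : ([0, 1, 2, 3, 7, 8].all fun x => !pushProg.writes x) = true := rfl
    simpa using List.all_eq_true.1 this x hx
  have harr : ∀ q < 8, ∀ i, arr n s'.mem q i = if q = 7 ∧ i = pathKey T k (v :: p) then 1 else
      if q = 6 ∧ i = L.length then p.length + 1 else
      if q = 5 ∧ i = L.length then pathKey T k (v :: p) else
      if q = 4 ∧ i = L.length then pathCost T (v :: p) else
      if q = 3 ∧ i = L.length then (v : ℕ) else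
      if q = 2 ∧ i = L.length then j else arr n s.mem q i := by
    intro q hq i
    rw [hm]
    simp only [arr_update (show 7 < 8 by norm_num) hq, arr_update (show 6 < 8 by norm_num) hq,
      arr_update (show 5 < 8 by norm_num) hq, arr_update (show 4 < 8 by norm_num) hq,
      arr_update (show 3 < 8 by norm_num) hq, arr_update (show 2 < 8 by norm_num) hq]
  refine ⟨h.base.congr hr (fun a ha => ?_) (fun i => ?_), ?_, h.explored.append hp hn, fun w => ?_,
    ?_, ?_, (f.reg 11 rfl).trans h.reg11, (f.reg 14 rfl).trans h.reg14,
    (f.reg 15 rfl).trans h.reg15, (f.reg 16 rfl).trans h.reg16⟩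
  · rw [hm]
    simp only [update_of_lt ha]
  · simp [harr]
  · refine h.table.append h.entry ?_ ?_ ?_ ?_ ?_ ?_ <;> intro i <;> simp [harr]
  · rw [harr 1 (by norm_num)]
    simpa using h.indicates w
  · rw [List.getElem?_append_left (List.getElem?_eq_some_iff.1 h.entry).1, h.entry]
  · rw [h10, List.length_append, List.length_singleton]

theorem halts_testProg {j : ℕ} {p : List (Fin n)} {v : Fin n} (hB : Base T R k P s)
    (hL : Table T k s.mem L) (hE : Explored T R k L)
    (hX : Indicates s.mem (v :: p).toFinset) (hp : L[j]? = some p) (hvp : v ∉ p)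
    (hv : s.reg 17 = v) (h15 : s.reg 15 = pathCost T p) (h16 : s.reg 16 = pathKey T k p)
    (h24 : s.reg 24 = cutSize T (v :: p).toFinset) :
    Halts testProg s 50 (fun s' => AgreeExceptIndicator n s.mem s'.mem ∧
      Indicates s'.mem p.toFinset ∧ s'.reg 30 = pathCost T (v :: p) ∧
      s'.reg 31 = pathKey T k (v :: p) ∧
      (s'.reg 26 = 0 ↔
        Valid T R k (v :: p) ∧ pathKey T k (v :: p) ∉ L.map (pathKey T k))) := by
  have hmem : (exec testProg s).mem = Function.update s.mem (n * n + 8 * v + 1) 0 := by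
    simp [testProg, exec, block, mem_exec_st, mem_exec_ld, hB.reg3, hv]
  have hm : AgreeExceptIndicator n s.mem (exec testProg s).mem := by
    rw [hmem]; exact .update _ _
  have hw : s.mem (n * n + 8 * v) = (k + 1) * 2 ^ (v : ℕ) := hB.weight v v.2
  have h31 := pathKey_cons (T := T) (k := k) v p
  have h30 : pathCost T (v :: p) = pathCost T p + cutSize T (v :: p).toFinset := rfl
  have h7 : Function.update s.mem (n * n + 8 * v + 1) 0 (n * n + 8 * pathKey T k (v :: p) + 7) =
      arr n s.mem 7 (pathKey T k (v :: p)) :=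
    Function.update_of_ne (by omega) _ _
  refine Halts.straight rfl (by decide) ⟨hm, fun w => ?_, ?_⟩
  · rw [hmem, arr_update (by norm_num) (by norm_num), hX w]
    simp only [true_and, ← Fin.ext_iff]
    by_cases h : w = v
    · subst h; simp [hvp]
    · simp [h]
  have hR : Valid T R k (v :: p) ↔ cutSize T (v :: p).toFinset ≤ R ∧ pathCost T (v :: p) ≤ k :=
    ⟨fun h => ⟨h.cutSize_le, h.pathCost_le⟩,
      fun h => .cons (hE.valid p (List.mem_of_getElem? hp)) hvp h.1 h.2⟩
  rw [hR, ← hL.seen]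
  generalize cutSize T (v :: p).toFinset = c at *
  generalize pathKey T k (v :: p) = key at *
  generalize pathCost T (v :: p) = cost at *
  have e : (k + 1) * 2 ^ (v : ℕ) + pathKey T k p + c = key := by rw [h31]; ring
  refine ⟨?_, ?_, ?_⟩
  · simp [testProg, exec, block, reg_exec_st, reg_exec_ld, h15, h24, h30]
  · simp [testProg, exec, block, reg_exec_st, reg_exec_ld, mem_exec_st, hB.reg3, hv, h16, h24, hw, e]
  -- With truncated subtraction this sum vanishes exactly if both bounds hold and the key is unseen.
  · have h26 : (exec testProg s).reg 26 = (c - R) + (cost - k) + arr n s.mem 7 key := by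
      simp [testProg, exec, block, reg_exec_st, reg_exec_ld, mem_exec_st, mem_exec_ld, hB.reg3, hv,
        h16, h24, hw, h15, hB.reg8, hB.reg1, ← h30, e, h7]
    rw [h26]
    omega

theorem halts_extendProg {j : ℕ} {p : List (Fin n)} {v : Fin n} (h : Expanding T R k P j p L s)
    (hv : s.reg 17 = v) :
    Halts extendProg s (n * (n * 20 + 30) + 170) (fun s' => ∃ L', L <+: L' ∧
      Expanding T R k P j p L' s' ∧
      (Valid T R k (v :: p) → pathKey T k (v :: p) ∈ L'.map (pathKey T k))) := by
  suffices hs : Halts extendProg s (8 + ((8 + ((n * (n * 20 + 30) + 30) + (50 + ((60 + 1) + 1))) + 1)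
      + 1)) (fun s' => ∃ L', L <+: L' ∧ Expanding T R k P j p L' s' ∧
        (Valid T R k (v :: p) → pathKey T k (v :: p) ∈ L'.map (pathKey T k))) from
    hs.mono (fun _ h _ => h) (by omega)
  refine Halts.seq (Halts.straight (Q := fun s' => s'.reg 25 = arr n s.mem 1 v) rfl (by decide)
    (by simp [reg_exec_ld, h.base.reg3, hv, arr])) fun s₁ h25 f1 => ?_
  have hm₁ : s₁.mem = s.mem := f1.mem rfl
  have h₁ : Expanding T R k P j p L s₁ :=
    h.frame f1 rfl (by rw [hm₁]; exact .refl) (by rw [hm₁]; exact h.indicates)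
  have hv₁ : s₁.reg 17 = v := (f1.reg 17 rfl).trans hv
  rw [h.indicates v] at h25
  refine Halts.seq (Q := fun s' => ∃ L', L <+: L' ∧ Expanding T R k P j p L' s' ∧
      (Valid T R k (v :: p) → pathKey T k (v :: p) ∈ L'.map (pathKey T k))) ?_
    fun s' h _ => .straight rfl le_rfl h
  refine Halts.cond (fun h0 => ?_) (fun h0 => ?_)
  · refine .straight rfl (by simp only [Prog.size]; omega) ⟨L, List.prefix_refl L, h₁, fun hvp => ?_⟩
    rw [h25] at h0
    have hv : v ∈ p := by simpa using h0
    have := hvp.nodup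
    simp [hv] at this
  have hvp : v ∉ p := by
    rw [h25] at h0
    simpa using h0
  refine Halts.seq (Halts.straight
    (Q := fun s' => s'.mem = Function.update s₁.mem (n * n + 8 * v + 1) 1) rfl (by decide)
    (by simp [mem_exec_st, h₁.base.reg3, h₁.base.reg2, hv₁])) fun s₂ h2 f2 => ?_
  have hm₂ : AgreeExceptIndicator n s₁.mem s₂.mem := by rw [h2]; exact .update _ _
  have hX : Indicates s₂.mem (v :: p).toFinset := by
    intro w
    rw [h2, arr_update (by norm_num) (by norm_num), h₁.indicates w]
    simp only [true_and, ← Fin.ext_iff, List.toFinset_cons, mem_insert]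
    by_cases hw : w = v <;> simp [hw]
  have hB₂ := h₁.base.frame f2 rfl hm₂
  refine Halts.seq (halts_cutProg hB₂ hX) fun s₃ ⟨h24, f3⟩ _ => ?_
  have hm₃ : s₃.mem = s₂.mem := f3.mem rfl
  have hreg : ∀ x, (st 1 17 2).writes x = false → cutProg.writes x = false →
      s₃.reg x = s₁.reg x := fun x hx hx' => (f3.reg x hx').trans (f2.reg x hx)
  refine Halts.seq (halts_testProg (hB₂.frame_of_not_stores f3 rfl rfl)
    (hm₃ ▸ h₁.table.congr hm₂) h₁.explored (hm₃ ▸ hX) h₁.entry hvp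
    ((hreg 17 rfl rfl).trans hv₁) ((hreg 15 rfl rfl).trans h₁.reg15)
    ((hreg 16 rfl rfl).trans h₁.reg16) h24) fun s₄ ⟨hm₄, hX₄, h30, h31, h26⟩ f4 => ?_
  have h₄ : Expanding T R k P j p L s₄ := by
    refine h₁.congr (fun x hx => ?_) (hm₂.trans (hm₃ ▸ hm₄)) hX₄
    have e1 : ([0, 1, 2, 3, 7, 8, 10, 11, 14, 15, 16].all fun x => !(st 1 17 2).writes x) = true :=
      rfl
    have e2 : ([0, 1, 2, 3, 7, 8, 10, 11, 14, 15, 16].all fun x => !cutProg.writes x) = true := rfl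
    have e3 : ([0, 1, 2, 3, 7, 8, 10, 11, 14, 15, 16].all fun x => !testProg.writes x) = true := rfl
    have e1 := List.all_eq_true.1 e1 x hx
    have e2 := List.all_eq_true.1 e2 x hx
    have e3 := List.all_eq_true.1 e3 x hx
    simp only [Bool.not_eq_true'] at e1 e2 e3
    exact (f4.reg x e3).trans (hreg x e1 e2)
  have hv₄ : s₄.reg 17 = v := ((f4.reg 17 rfl).trans (hreg 17 rfl rfl)).trans hv₁
  refine Halts.seq (Q := fun s' => ∃ L', L <+: L' ∧ Expanding T R k P j p L' s' ∧
      (Valid T R k (v :: p) → pathKey T k (v :: p) ∈ L'.map (pathKey T k))) ?_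
    fun s' h _ => .straight rfl le_rfl h
  refine Halts.cond (fun h0 => ?_) (fun h0 => ?_)
  · refine .straight rfl (by simp only [Prog.size]; omega) ⟨L, List.prefix_refl L, h₄, fun hval => ?_⟩
    by_contra hn
    exact h0 (h26.2 ⟨hval, hn⟩)
  · obtain ⟨hval, hn⟩ := h26.1 h0
    exact (halts_pushProg h₄ hv₄ h30 h31 hval hn).mono
      (fun s' h _ => ⟨_, List.prefix_append _ _, h, fun _ => by simp⟩) le_rfl

theorem halts_expandProg {j : ℕ} {p : List (Fin n)} (hB : Base T R k P s)
    (hL : Table T k s.mem L) (hE : Explored T R k L) (hX : Indicates s.mem p.toFinset)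
    (hp : L[j]? = some p) (h10 : s.reg 10 = L.length) (h11 : s.reg 11 = j)
    (h14 : s.reg 14 = p.length) :
    Halts expandProg s (n * (n * (n * 20 + 30) + 173) + 30) (fun s' => ∃ L', L <+: L' ∧
      Base T R k P s' ∧ Table T k s'.mem L' ∧ Explored T R k L' ∧ s'.reg 10 = L'.length ∧
      s'.reg 11 = j + 1 ∧ ClosedAt T R k L' p) := by
  suffices hs : Halts expandProg s (17 + (n * ((n * (n * 20 + 30) + 170) + 3) + 3 + 2))
      (fun s' => ∃ L', L <+: L' ∧
        Base T R k P s' ∧ Table T k s'.mem L' ∧ Explored T R k L' ∧ s'.reg 10 = L'.length ∧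
        s'.reg 11 = j + 1 ∧ ClosedAt T R k L' p) from
    hs.mono (fun _ h _ => h) (by ring_nf; omega)
  refine Halts.seq (Halts.straight (Q := fun s' => s'.reg 15 = pathCost T p ∧
    s'.reg 16 = pathKey T k p) rfl (by decide) ?_) fun s₁ ⟨h15, h16⟩ f1 => ?_
  · obtain ⟨e1, e2, -⟩ := hL.data j p hp
    unfold arr at e1 e2
    simp [exec, block, reg_exec_ld, mem_exec_ld, hB.reg3, h11, e1, e2]
  have hm₁ : s₁.mem = s.mem := f1.mem rfl
  have h₁ : Expanding T R k P j p L s₁ :=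
    ⟨hB.frame_of_not_stores f1 rfl rfl, hm₁ ▸ hL, hE, hm₁ ▸ hX, hp, (f1.reg 10 rfl).trans h10,
      (f1.reg 11 rfl).trans h11, (f1.reg 14 rfl).trans h14, h15, h16⟩
  refine Halts.seq (Halts.forLt (fun i s' => ∃ L', L <+: L' ∧ Expanding T R k P j p L' s' ∧
    ∀ v : Fin n, (v : ℕ) < i → Valid T R k (v :: p) →
      pathKey T k (v :: p) ∈ L'.map (pathKey T k)) rfl h₁.base.reg0 h₁.base.reg2 ?_
    ⟨L, List.prefix_refl L, h₁, by simp⟩ ?_) ?_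
  · rintro i s' w x ⟨L', h1, h2, h3⟩
    exact ⟨L', h1, h2.congr (by simp) (by simpa using .refl) (by simpa using h2.indicates), h3⟩
  · rintro i hi s₂ ⟨L', h1, h2, h3⟩ hv -
    refine (halts_extendProg (v := ⟨i, hi⟩) h2 hv).mono (fun s₃ ⟨L'', h4, h5, h6⟩ _ => ?_) le_rfl
    refine ⟨L'', h1.trans h4, h5, fun v hv hval => ?_⟩
    rcases Nat.lt_succ_iff_lt_or_eq.1 hv with hv | hv
    · exact (h4.map _).subset (h3 v hv hval)
    · obtain rfl : v = ⟨i, hi⟩ := Fin.ext hv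
      exact h6 hval
  · rintro s₂ ⟨L', h1, h2, h3⟩ f2
    refine (Halts.straight (Q := fun s' => s'.reg 11 = j + 1) rfl (by decide) ?_).mono
      (fun s₃ h4 f3 => ?_) le_rfl
    · simp [exec, block, h2.reg11, h2.base.reg2]
    have hm₃ : s₃.mem = s₂.mem := f3.mem rfl
    exact ⟨L', h1, h2.base.frame_of_not_stores f3 rfl rfl, hm₃ ▸ h2.table, h2.explored,
      (f3.reg 10 rfl).trans h2.reg10, h4, fun v => h3 v v.2⟩

end OLA


namespace OLA

open Finset RAM

variable {n : ℕ} {T : Digraph (Fin n)} {R k P : ℕ} {s s' : State} {L : List (List (Fin n))}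
  {m m' m'' : ℕ → ℕ}

/-! ### The search -/

theorem ClosedAt.mono {L' : List (List (Fin n))} {p : List (Fin n)} (h : ClosedAt T R k L p)
    (hL : L <+: L') : ClosedAt T R k L' p :=
  fun v hv => (hL.map _).subset (h v hv)

/-- The invariant of the search. -/
structure Searching (T : Digraph (Fin n)) (R k P : ℕ) (L : List (List (Fin n))) (s : State) :
    Prop where
  base : Base T R k P s
  table : Table T k s.mem L
  explored : Explored T R k L
  reg10 : s.reg 10 = L.length
  closed : ∀ j < s.reg 11, ∀ p, L[j]? = some p → ClosedAt T R k L p ∧ p.length ≠ n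
  found : s.reg 12 ≠ 0 → ∃ p, L[s.reg 11]? = some p ∧ p.length = n

/-- The search goes on. -/
def Active (P : ℕ) (s : State) : Prop := s.reg 12 = 0 ∧ s.reg 10 ≤ P ∧ s.reg 11 < s.reg 10

theorem halts_guardProg (h : Searching T R k P L s) :
    Halts guardProg s 10 (fun s' => Searching T R k P L s' ∧ s'.reg 11 = s.reg 11 ∧
      (s'.reg 9 ≠ 0 ↔ Active P s')) := by
  refine (Halts.straight (Q := fun s' => s'.reg 9 ≠ 0 ↔ Active P s) rfl (by decide) ?_).mono
    (fun s' h1 f => ?_) le_rfl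
  · unfold Active
    by_cases h1 : P + 1 - s.reg 10 = 0 <;> by_cases h2 : s.reg 12 = 0 <;>
      simp [exec, guardProg, block, h.base.reg7, h.base.reg2, h1, h2] <;> omega
  · have hm : s'.mem = s.mem := f.mem rfl
    have e10 : s'.reg 10 = s.reg 10 := f.reg 10 rfl
    have e11 : s'.reg 11 = s.reg 11 := f.reg 11 rfl
    have e12 : s'.reg 12 = s.reg 12 := f.reg 12 rfl
    refine ⟨⟨h.base.frame_of_not_stores f rfl rfl, hm ▸ h.table, h.explored, e10.trans h.reg10,
      e11 ▸ h.closed, ?_⟩, e11, ?_⟩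
    · rw [e11, e12]; exact h.found
    · unfold Active at h1 ⊢
      rw [h1, e10, e11, e12]

/-- A bound for the time of one step of the search. -/
def searchTime (n : ℕ) : ℕ := n * (n * (n * 20 + 30) + 173) + n * 41 + 80

theorem halts_searchProg (h : Searching T R k P L s) (ha : Active P s) :
    Halts searchProg s (searchTime n) (fun s' => ∃ L', Searching T R k P L' s' ∧
      (s'.reg 9 ≠ 0 ↔ Active P s') ∧ (s'.reg 9 ≠ 0 → s'.reg 11 = s.reg 11 + 1)) := by
  obtain ⟨a12, a10, a11⟩ := ha
  rw [h.reg10] at a11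
  obtain ⟨p, hp⟩ : ∃ p, L[s.reg 11]? = some p := ⟨_, List.getElem?_eq_getElem a11⟩
  have hval : Valid T R k p := h.explored.valid p (List.mem_of_getElem? hp)
  have hlen : p.length ≤ n := by simpa using hval.nodup.length_le_card
  suffices hs : Halts searchProg s ((n * 13 + 3 + (11 + (p.length * 28 + 4))) +
      (1 + (((n * (n * (n * 20 + 30) + 173) + 30) + 1) + (10 + 1)))) (fun s' => ∃ L',
      Searching T R k P L' s' ∧ (s'.reg 9 ≠ 0 ↔ Active P s') ∧
        (s'.reg 9 ≠ 0 → s'.reg 11 = s.reg 11 + 1)) from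
    hs.mono (fun _ h _ => h) (by unfold searchTime; omega)
  refine Halts.seq (halts_decodeProg h.base h.table hp) fun s₁ ⟨hB₁, hm₁, hX₁, h14, _⟩ f1 => ?_
  refine Halts.seq (Halts.straight (Q := fun s' => s'.reg 25 = n - p.length) rfl le_rfl
    (by simp [exec, hB₁.reg0, h14])) fun s₂ h25 f2 => ?_
  have hm₂ : s₂.mem = s₁.mem := f2.mem rfl
  have hB₂ := hB₁.frame_of_not_stores f2 rfl rfl
  have hT₂ : Table T k s₂.mem L := hm₂ ▸ h.table.congr hm₁
  have e10 : s₂.reg 10 = L.length := ((f2.reg 10 rfl).trans (f1.reg 10 rfl)).trans h.reg10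
  have e11 : s₂.reg 11 = s.reg 11 := (f2.reg 11 rfl).trans (f1.reg 11 rfl)
  have e12 : s₂.reg 12 = 0 := ((f2.reg 12 rfl).trans (f1.reg 12 rfl)).trans a12
  refine Halts.seq (Q := fun s' => ∃ L', Searching T R k P L' s' ∧
    (s'.reg 12 = 0 → s'.reg 11 = s.reg 11 + 1)) (Halts.cond (fun h0 => ?_) (fun h0 => ?_)) ?_
  · refine (halts_expandProg hB₂ hT₂ h.explored (hm₂ ▸ hX₁) hp e10 e11
      ((f2.reg 14 rfl).trans h14)).mono (fun s₃ ⟨L', h1, h2, h3, h4, h5, h6, h7⟩ f3 => ?_) le_rfl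
    have e12' : s₃.reg 12 = 0 := (f3.reg 12 rfl).trans e12
    refine ⟨L', ⟨h2, h3, h4, h5, fun j hj q hq => ?_, fun h => absurd e12' h⟩, fun _ => h6⟩
    rw [h6] at hj
    have hjL : j < L.length := by omega
    have hq' : L[j]? = some q := by
      rw [List.getElem?_eq_getElem hjL, ← hq, List.getElem?_eq_getElem (by have := h1.length_le; omega),
        h1.getElem hjL]
    rcases Nat.lt_succ_iff_lt_or_eq.1 hj with hj | rfl
    · obtain ⟨c1, c2⟩ := h.closed j hj q hq'
      exact ⟨c1.mono h1, c2⟩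
    · rw [hp] at hq'
      obtain rfl := Option.some.inj hq'
      exact ⟨h7, by omega⟩
  · refine (Halts.straight (t := 1) (Q := fun s' => s'.reg 12 = 1) rfl le_rfl
      (by simp [exec])).mono (fun s₃ h3 f3 => ?_) (by omega)
    have hm₃ : s₃.mem = s₂.mem := f3.mem rfl
    have e11' : s₃.reg 11 = s.reg 11 := (f3.reg 11 rfl).trans e11
    refine ⟨L, ⟨hB₂.frame_of_not_stores f3 rfl rfl, hm₃ ▸ hT₂, h.explored,
      (f3.reg 10 rfl).trans e10, e11' ▸ h.closed, fun _ => ⟨p, e11' ▸ hp, by omega⟩⟩, fun h => ?_⟩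
    omega
  · rintro s₃ ⟨L', h3, h3'⟩ -
    refine Halts.seq (halts_guardProg h3) fun s₄ ⟨h4, h5, h6⟩ f4 => ?_
    refine (Halts.straight (p := .skip) (Q := fun s' => s' = s₄) rfl le_rfl rfl).mono ?_ le_rfl
    rintro s₅ rfl -
    refine ⟨L', h4, h6, fun h9 => h5.trans (h3' ?_)⟩
    rw [← f4.reg 12 rfl]
    exact (h6.1 h9).1

/-- While the guard is nonzero, register `11` equals the number of completed rounds and is less than
the queue length, which is at most `P`. The last round may leave register `11` in place, hence the
condition in the invariant. -/
theorem halts_loop_searchProg (h : Searching T R k P L s) (h11 : s.reg 11 = 0)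
    (ha : s.reg 9 ≠ 0 ↔ Active P s) :
    Halts (.loop 9 searchProg) s (P * (searchTime n + 1) + 1)
      (fun s' => ∃ L', Searching T R k P L' s' ∧ ¬ Active P s') := by
  refine (Halts.loop (fun i s' => ∃ L', Searching T R k P L' s' ∧ (s'.reg 9 ≠ 0 ↔ Active P s') ∧
    (s'.reg 9 ≠ 0 → s'.reg 11 = i)) ⟨L, h, ha, fun _ => h11⟩ ?_).mono ?_ le_rfl
  · rintro i s₁ ⟨L', h1, h2, h3⟩ - h9
    obtain ⟨a12, a10, a11⟩ := h2.1 h9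
    have := h3 h9
    refine ⟨by omega, (halts_searchProg h1 (h2.1 h9)).mono ?_ le_rfl⟩
    rintro s₂ ⟨L'', h4, h5, h6⟩ -
    exact ⟨L'', h4, h5, fun h => by rw [h6 h, this]⟩
  · rintro s₁ ⟨h9, i, L', h1, h2, -⟩ -
    exact ⟨L', h1, fun h => h2.2 h h9⟩

/-- If a cheap ordering existed, the budget could not be exceeded, so the search stopped because the
queue was exhausted. Then every valid path is represented, and some processed path would be
complete. -/
theorem Searching.not_exists {r : ℕ} (h : Searching T (3 * r ^ 2) k ((n + 1) * 2 ^ (22 * r)) L s)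
    (ha : ¬ Active ((n + 1) * 2 ^ (22 * r)) s) (h12 : s.reg 12 = 0) (hT : IsSemicomplete T)
    (hr : 1 ≤ r) (hk : k ≤ r ^ 3) : ¬ ∃ σ : Fin n ≃ Fin n, cost T σ ≤ k := by
  intro hσ
  have h1 := h.explored.length_le_of_exists hT hr hk hσ
  have h2 : L.length ≤ s.reg 11 := by
    by_contra! h2
    rw [← h.reg10] at h1 h2
    exact ha ⟨h12, h1, h2⟩
  have hc : ∀ p ∈ L, ClosedAt T (3 * r ^ 2) k L p ∧ p.length ≠ n := by
    intro p hp
    obtain ⟨j, hj⟩ := List.mem_iff_getElem?.1 hp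
    have := (List.getElem?_eq_some_iff.1 hj).1
    exact h.closed j (by omega) p hj
  obtain ⟨p, hp, hn⟩ := h.explored.exists_length_eq (fun p hp => (hc p hp).1) hk hσ
  exact (hc p hp).2 hn

/-! ### Output -/

theorem halts_outputProg (hB : Base T R k P s) (hL : Table T k s.mem L) {p : List (Fin n)}
    (hp : L[s.reg 11]? = some p) (hn : p.length = n) {σ : Fin n ≃ Fin n}
    (hσ : ∀ i : Fin n, p[n - 1 - (i : ℕ)]? = some (σ i)) :
    Halts outputProg s (n * 24 + 10) (fun s' => Reports s' σ) := by
  suffices hs : Halts outputProg s (4 + ((n * (21 + 3) + 3) + (1 + 1))) (fun s' => Reports s' σ) from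
    hs.mono (fun _ h _ => h) (by omega)
  refine Halts.seq (Halts.straight (Q := fun s' => s'.reg 13 = s.reg 11 ∧ s'.reg 33 = n) rfl
    (by decide) (by simp [exec, block, hB.reg0])) fun s₁ ⟨h13, h33⟩ f1 => ?_
  have hB₁ := hB.frame_of_not_stores f1 rfl rfl
  have hm₁ : s₁.mem = s.mem := f1.mem rfl
  refine Halts.seq (Halts.forLt (fun i s' => s'.reg 33 = n - i ∧ L[s'.reg 13]? = some (p.drop i) ∧
    (∀ a, n * n ≤ a → s'.mem a = s.mem a) ∧ ∀ a : Fin n, n - i ≤ a → s'.mem a = σ a) rfl hB₁.reg0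
    hB₁.reg2 ?_ ⟨h33, by rw [h13, hp, List.drop_zero], by simp [hm₁], fun a ha => by omega⟩ ?_) ?_
  · rintro i s' w x ⟨h1, h2, h3, h4⟩
    exact ⟨by simpa using h1, by simpa using h2, h3, h4⟩
  · rintro i hi s₂ ⟨h1, h2, h3, h4⟩ hv f2
    have r2 : s₂.reg 2 = 1 := (f2.reg 2 rfl).trans hB₁.reg2
    have r3 : s₂.reg 3 = n * n := (f2.reg 3 rfl).trans hB₁.reg3
    have hi' : i < p.length := by omega
    rw [List.drop_eq_getElem_cons hi'] at h2
    obtain ⟨l1, l2⟩ := hL.link _ _ _ h2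
    have e3 : s₂.mem (n * n + 8 * s₂.reg 13 + 3) = p[i] := by rw [h3 _ (by omega)]; exact l1
    have e2 : s₂.mem (n * n + 8 * s₂.reg 13 + 2) = arr n s.mem 2 (s₂.reg 13) := by
      rw [h3 _ (by omega)]; rfl
    -- The output overwrites only part of the adjacency matrix, so the links still to be followed
    -- stay intact.
    have hnn : n ≤ n * n := Nat.le_mul_self n
    have e2' : Function.update s₂.mem (n - i - 1) (p[i] : ℕ) (n * n + 8 * s₂.reg 13 + 2) =
        arr n s.mem 2 (s₂.reg 13) := by
      rw [Function.update_of_ne (by omega), e2]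
    refine (Halts.straight (Q := fun s' => s'.mem = Function.update s₂.mem (n - i - 1) (p[i] : ℕ) ∧
      s'.reg 33 = n - i - 1 ∧ s'.reg 13 = arr n s.mem 2 (s₂.reg 13)) rfl (by decide) ?_).mono
      (fun s₃ ⟨hm, g33, g13⟩ _ => ⟨by omega, ?_, fun a ha => ?_, fun a ha => ?_⟩) le_rfl
    · simp [exec, block, reg_exec_ld, mem_exec_ld, r2, r3, h1, e3, e2']
    · rw [g13, l2]
    · rw [hm, Function.update_of_ne (by omega), h3 a ha]
    · rw [hm, Function.update_apply]
      split_ifs with hai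
      · have := hσ a
        rw [show n - 1 - (a : ℕ) = i by omega, List.getElem?_eq_getElem hi'] at this
        rw [Option.some.inj this]
      · exact h4 a (by omega)
  · rintro s₂ ⟨-, -, -, h4⟩ -
    refine Halts.straight rfl (by decide) ⟨by simp [exec, block], fun i => ?_⟩
    simpa [exec, block] using h4 i (by omega)

/-! ### Initialization -/

/-- Registers `4`, `5`, `6` run through `r`, `r ^ 2`, `r ^ 3` by binomial expansion, and the budget
gains a factor `2 ^ 22` per round. At most `k` rounds occur because `r ≤ r ^ 3 < k` whenever the
loop continues. -/
theorem halts_parameterProg (T : Digraph (Fin n)) (k : ℕ) :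
    Halts parameterProg (inputState T k) (n * 4 + k * 43 + 60) (fun s' =>
      Frame parameterProg (inputState T k) s' ∧ s'.reg 2 = 1 ∧ s'.reg 3 = n * n ∧
      ∃ r, s'.reg 7 = (n + 1) * 2 ^ (22 * r) ∧ s'.reg 8 = 3 * r ^ 2 ∧ 1 ≤ r ∧ k ≤ r ^ 3 ∧
        (r = 1 ∨ (r - 1) ^ 3 < k)) := by
  have r0 : (inputState T k).reg 0 = n := rfl
  have r1 : (inputState T k).reg 1 = k := rfl
  suffices hs : Halts parameterProg (inputState T k) (1 + (1 + ((n * (1 + 3) + 3) + (29 +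
      ((k * (42 + 1) + 1) + (3 + 1)))))) (fun s' => s'.reg 2 = 1 ∧ s'.reg 3 = n * n ∧
      ∃ r, s'.reg 7 = (n + 1) * 2 ^ (22 * r) ∧ s'.reg 8 = 3 * r ^ 2 ∧ 1 ≤ r ∧ k ≤ r ^ 3 ∧
        (r = 1 ∨ (r - 1) ^ 3 < k)) from
    hs.mono (fun _ h f => ⟨f, h⟩) (by omega)
  refine Halts.seq (Halts.straight (Q := fun s' => s'.reg 2 = 1) rfl le_rfl (by simp [exec]))
    fun s₁ h1 f1 => ?_
  refine Halts.seq (Halts.straight (Q := fun s' => s'.reg 3 = 0) rfl le_rfl (by simp [exec]))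
    fun s₂ h2 f2 => ?_
  refine Halts.seq (Halts.forLt (m := n) (fun i s' => s'.reg 3 = i * n) rfl
    (((f2.reg 0 rfl).trans (f1.reg 0 rfl)).trans r0) ((f2.reg 2 rfl).trans h1)
    (by intro i s' w x h; simpa using h) (by simp [h2]) ?_) fun s₃ h3 f3 => ?_
  · intro i hi s₃ h3 hv f3
    have h0 : s₃.reg 0 = n := (((f3.reg 0 rfl).trans (f2.reg 0 rfl)).trans (f1.reg 0 rfl)).trans r0
    exact .straight rfl le_rfl (by simp [exec, h3, h0]; ring)
  have h20 : s₃.reg 2 = 1 := ((f3.reg 2 rfl).trans (f2.reg 2 rfl)).trans h1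
  have h0 : s₃.reg 0 = n := (((f3.reg 0 rfl).trans (f2.reg 0 rfl)).trans (f1.reg 0 rfl)).trans r0
  have h10 : s₃.reg 1 = k := (((f3.reg 1 rfl).trans (f2.reg 1 rfl)).trans (f1.reg 1 rfl)).trans r1
  refine Halts.seq (Halts.straight (Q := fun s' => s'.reg 4 = 1 ∧ s'.reg 5 = 1 ∧ s'.reg 6 = 1 ∧
    s'.reg 7 = (n + 1) * 2 ^ 22 ∧ s'.reg 9 = k - 1) rfl (by decide) ?_)
    fun s₄ ⟨g4, g5, g6, g7, g9⟩ f4 => ?_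
  · simp [exec, block, (exec_double 7 22 _).2, h20, h0, h10]
  have h24 : s₄.reg 2 = 1 := (f4.reg 2 rfl).trans h20
  have h14 : s₄.reg 1 = k := (f4.reg 1 rfl).trans h10
  refine Halts.seq (Halts.loop (B := k) (fun i s' => s'.reg 4 = i + 1 ∧ s'.reg 5 = (i + 1) ^ 2 ∧
    s'.reg 6 = (i + 1) ^ 3 ∧ s'.reg 7 = (n + 1) * 2 ^ (22 * (i + 1)) ∧
    s'.reg 9 = k - (i + 1) ^ 3 ∧ (i = 0 ∨ i ^ 3 < k)) ?_ ?_) ?_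
  · simpa using ⟨g4, g5, g6, g7, g9⟩
  · rintro i s₅ ⟨i4, i5, i6, i7, i9, -⟩ f5 hne
    have h25 : s₅.reg 2 = 1 := (f5.reg 2 rfl).trans h24
    have h15 : s₅.reg 1 = k := (f5.reg 1 rfl).trans h14
    have hlt : (i + 1) ^ 3 < k := by omega
    have hle : i + 1 ≤ (i + 1) ^ 3 := Nat.le_self_pow (by norm_num) _
    refine ⟨by omega, .straight rfl (by decide) ?_⟩
    have e6 : (i + 1) ^ 3 + (i + 1) ^ 2 + (i + 1) ^ 2 + (i + 1) ^ 2 + (i + 1) + (i + 1) + (i + 1) +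
      1 = (i + 1 + 1) ^ 3 := by ring
    have e5 : (i + 1) ^ 2 + (i + 1) + (i + 1) + 1 = (i + 1 + 1) ^ 2 := by ring
    have e7 : (n + 1) * 2 ^ (22 * (i + 1)) * 2 ^ 22 = (n + 1) * 2 ^ (22 * (i + 1 + 1)) := by ring
    simp [exec, block, (exec_double 7 22 _).2, h25, h15, i4, i5, i6, i7, e6, e5, hlt, -Nat.reducePow,
      e7]
  · rintro s₅ ⟨i9, i, i4, i5, i6, i7, i9', hi⟩ f5
    have h35 : s₅.reg 3 = n * n := ((f5.reg 3 rfl).trans (f4.reg 3 rfl)).trans h3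
    have h25 : s₅.reg 2 = 1 := (f5.reg 2 rfl).trans h24
    refine Halts.seq (t' := 1) (Q := fun s' => s'.reg 2 = 1 ∧ s'.reg 3 = n * n ∧
      ∃ r, s'.reg 7 = (n + 1) * 2 ^ (22 * r) ∧ s'.reg 8 = 3 * r ^ 2 ∧ 1 ≤ r ∧ k ≤ r ^ 3 ∧
        (r = 1 ∨ (r - 1) ^ 3 < k)) (.straight rfl (by decide) ?_)
      fun s' h _ => .straight rfl le_rfl h
    refine ⟨by simp [exec, block, h25], by simp [exec, block, h35], i + 1,
      by simp [exec, block, i7], by simp [exec, block, i5]; ring, by omega, by omega, ?_⟩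
    simpa using hi

/-- The empty path has cost, key and length `0`, so zeroed memory already describes it; only its
mark in array `7` and the queue length must be set. -/
theorem halts_arrayProg (hs : Frame parameterProg (inputState T k) s) (h2 : s.reg 2 = 1)
    (h3 : s.reg 3 = n * n) (h7 : s.reg 7 = P) (h8 : s.reg 8 = R) :
    Halts arrayProg s (n * 13 + 20) (fun s' => Searching T R k P [[]] s' ∧ s'.reg 11 = 0) := by
  suffices h : Halts arrayProg s (1 + ((n * (10 + 3) + 3) + (11 + 1)))
      (fun s' => Searching T R k P [[]] s' ∧ s'.reg 11 = 0) from
    h.mono (fun _ h _ => h) (by omega)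
  have r0 : s.reg 0 = n := (hs.reg 0 rfl).trans rfl
  have r1 : s.reg 1 = k := (hs.reg 1 rfl).trans rfl
  have hm : s.mem = (inputState T k).mem := hs.mem rfl
  have hzero : ∀ q i, arr n s.mem q i = 0 := by
    intro q i
    rw [hm]
    unfold arr inputState
    refine if_neg ?_
    rintro ⟨a, b, h, -⟩
    have := a.2; have := b.2
    nlinarith
  have hmat : ∀ i j : Fin n, s.mem ((i : ℕ) * n + j) = open Classical in if T.Adj i j then 1 else 0 := by
    classical
    intro i j
    rw [hm]
    unfold inputState
    by_cases hT : T.Adj i j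
    · rw [if_pos hT]
      exact if_pos ⟨i, j, rfl, hT⟩
    · rw [if_neg hT]
      refine if_neg ?_
      rintro ⟨a, b, h, hab⟩
      have hj := j.2; have hb := b.2
      have hi : (i : ℕ) = a := by
        have := congrArg (· / n) h
        simpa [Nat.add_div_of_dvd_right, Nat.mul_div_cancel _ (show 0 < n by omega),
          Nat.div_eq_of_lt hj, Nat.div_eq_of_lt hb] using this
      have hj : (j : ℕ) = b := by rw [hi] at h; omega
      obtain rfl := Fin.ext hi
      obtain rfl := Fin.ext hj
      exact hT hab
  refine Halts.seq (Halts.straight (Q := fun s' => s'.reg 25 = k + 1) rfl le_rfl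
    (by simp [exec, r1, h2])) fun s₁ h25 f1 => ?_
  have hm₁ : s₁.mem = s.mem := f1.mem rfl
  have h2₁ : s₁.reg 2 = 1 := (f1.reg 2 rfl).trans h2
  refine Halts.seq (Halts.forLt (fun i s' => s'.reg 25 = (k + 1) * 2 ^ i ∧
    (∀ j < i, arr n s'.mem 0 j = (k + 1) * 2 ^ j) ∧ (∀ a < n * n, s'.mem a = s.mem a) ∧
    ∀ q < 8, q ≠ 0 → ∀ i, arr n s'.mem q i = 0) rfl ((f1.reg 0 rfl).trans r0) h2₁ ?_
    ⟨by simp [h25], by simp, by simp [hm₁], fun q _ _ i => by rw [hm₁, hzero]⟩ ?_) ?_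
  · rintro i s' w x ⟨a1, a2, a3, a4⟩
    exact ⟨by simpa using a1, a2, a3, a4⟩
  · rintro i hi s₂ ⟨a1, a2, a3, a4⟩ hv f2
    have h3₂ : s₂.reg 3 = n * n := ((f2.reg 3 rfl).trans (f1.reg 3 rfl)).trans h3
    refine (Halts.straight (Q := fun s' => s'.reg 25 = (k + 1) * 2 ^ (i + 1) ∧
      s'.mem = Function.update s₂.mem (n * n + 8 * i + 0) ((k + 1) * 2 ^ i)) rfl (by decide)
      ?_).mono (fun s₃ ⟨b1, b2⟩ f3 => ⟨b1, fun j hj => ?_, fun a ha => ?_, fun q hq hq' j => ?_⟩)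
      le_rfl
    · have : (k + 1) * 2 ^ i + (k + 1) * 2 ^ i = (k + 1) * 2 ^ (i + 1) := by ring
      simp [exec, block, reg_exec_st, mem_exec_st, h3₂, hv, a1, this]
    · rw [b2, arr_update (by norm_num) (by norm_num)]
      split_ifs with h
      · rw [h.2]
      · exact a2 j (by omega)
    · rw [b2, update_of_lt ha, a3 a ha]
    · rw [b2, arr_update (by norm_num) hq, if_neg (fun h => hq' h.1), a4 q hq hq']
  · rintro s₂ ⟨-, a2, a3, a4⟩ f2
    have e : ∀ x, arrayProg.writes x = false → s₂.reg x = s.reg x := by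
      intro x hx
      simp only [arrayProg, block, Prog.writes, Bool.or_eq_false_iff] at hx
      exact (f2.reg x hx.2.1).trans (f1.reg x (by simpa [Prog.writes] using hx.1))
    have h10 : s₂.reg 10 = 0 :=
      ((f2.reg 10 rfl).trans (f1.reg 10 rfl)).trans ((hs.reg 10 rfl).trans rfl)
    have h3₂ : s₂.reg 3 = n * n := (e 3 rfl).trans h3
    have h2₂ : s₂.reg 2 = 1 := (e 2 rfl).trans h2
    refine Halts.seq (Halts.straight (Q := fun s' => s'.reg 10 = 1 ∧
      s'.mem = Function.update s₂.mem (n * n + 8 * 0 + 7) 1) rfl (by decide) ?_)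
      fun s₃ ⟨b10, b⟩ f3 => ?_
    · simp [exec, block, mem_exec_st, h3₂, h10, h2₂]
    refine (Halts.straight (p := .skip) (Q := fun s' => s' = s₃) rfl le_rfl rfl).mono ?_ le_rfl
    rintro s₄ rfl -
    have harr : ∀ q < 8, ∀ i, arr n s₄.mem q i =
        if q = 7 ∧ i = 0 then 1 else arr n s₂.mem q i := by
      intro q hq i
      rw [b, arr_update (by norm_num) hq]
    have e11 : s₄.reg 11 = 0 := (f3.reg 11 rfl).trans ((e 11 rfl).trans ((hs.reg 11 rfl).trans rfl))
    have e12 : s₄.reg 12 = 0 := (f3.reg 12 rfl).trans ((e 12 rfl).trans ((hs.reg 12 rfl).trans rfl))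
    refine ⟨⟨⟨(f3.reg 0 rfl).trans ((e 0 rfl).trans r0), (f3.reg 1 rfl).trans ((e 1 rfl).trans r1),
      (f3.reg 2 rfl).trans h2₂, (f3.reg 3 rfl).trans h3₂, (f3.reg 7 rfl).trans ((e 7 rfl).trans h7),
      (f3.reg 8 rfl).trans ((e 8 rfl).trans h8), fun i j => ?_, fun i hi => ?_⟩, ⟨?_, ?_, ?_⟩,
      Explored.singleton, b10, by simp [e11], by simp [e12]⟩, e11⟩
    · have hij : (i : ℕ) * n + j < n * n := by
        have := i.2; have := j.2
        nlinarith
      rw [b, update_of_lt hij, a3 _ hij, hmat]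
    · rw [harr 0 (by norm_num)]
      simpa using a2 i hi
    · intro j v p h
      rw [List.getElem?_singleton] at h
      split_ifs at h
      simp at h
    · intro j p h
      rw [List.getElem?_singleton] at h
      split_ifs at h
      obtain rfl := Option.some.inj h
      simp [harr, a4, pathCost, pathKey, pathWeight]
    · intro x
      rw [harr 7 (by norm_num), a4 7 (by norm_num) (by norm_num)]
      simp [pathKey, pathCost, pathWeight]

/-! ### The algorithm -/

theorem halts_orderingProg (hT : IsSemicomplete T) (k : ℕ) :
    ∃ r, (r = 1 ∨ (r - 1) ^ 3 < k) ∧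
      Halts orderingProg (inputState T k) (1000 * (n + 1) ^ 4 * 2 ^ (22 * r)) (fun s =>
        (∃ σ : Fin n ≃ Fin n, Reports s σ ∧ cost T σ ≤ k) ∨
          (ReportsNone s ∧ ¬ ∃ σ : Fin n ≃ Fin n, cost T σ ≤ k)) := by
  obtain ⟨s₁, t₁, run₁, ht₁, f1, h2, h3, r, h7, h8, hr, hk, hr'⟩ := halts_parameterProg T k
  refine ⟨r, hr', ?_⟩
  set P := (n + 1) * 2 ^ (22 * r)
  suffices h : Halts orderingProg (inputState T k) ((n * 4 + k * 43 + 60) + ((n * 13 + 20) + (10 +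
      ((P * (searchTime n + 1) + 1) + (((n * 24 + 10) + 1) + 1))))) _ from by
    refine h.mono (fun _ h _ => h) ?_
    -- Absorbs the time linear in `k` spent on the parameters.
    have hk' : k ≤ 2 ^ (22 * r) := by
      refine hk.trans ?_
      calc r ^ 3 ≤ (2 ^ r) ^ 3 := Nat.pow_le_pow_left Nat.lt_two_pow_self.le 3
        _ = 2 ^ (r * 3) := (pow_mul _ _ _).symm
        _ ≤ 2 ^ (22 * r) := Nat.pow_le_pow_right (by norm_num) (by omega)
    have h1 : 1 ≤ 2 ^ (22 * r) := Nat.one_le_two_pow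
    simp only [P, searchTime]
    generalize 2 ^ (22 * r) = A at hk' h1
    have h4 : n * 41 + 101 + k * 43 + 2 ≤ (n * 41 + 146) * A := by nlinarith
    have h5 : (n * 41 + 146) * A + (n + 1) * A * (n * (n * (n * 20 + 30) + 173) + n * 41 + 80 + 1) ≤
        1000 * (n + 1) ^ 4 * A := by
      have : (n * 41 + 146) + (n + 1) * (n * (n * (n * 20 + 30) + 173) + n * 41 + 80 + 1) ≤
          1000 * (n + 1) ^ 4 := by ring_nf; omega
      calc _ = ((n * 41 + 146) + (n + 1) * (n * (n * (n * 20 + 30) + 173) + n * 41 + 80 + 1)) * A := by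
            ring
        _ ≤ _ := Nat.mul_le_mul_right _ this
    omega
  refine Halts.seq (Q := fun s => s = s₁) ⟨s₁, t₁, run₁, ht₁, rfl⟩ ?_
  rintro _ rfl -
  refine Halts.seq (halts_arrayProg (T := T) (k := k) f1 h2 h3 h7 h8)
    fun s₂ ⟨hS, h11⟩ _ => ?_
  refine Halts.seq (halts_guardProg hS) fun s₃ ⟨hS₃, h11₃, h9⟩ _ => ?_
  refine Halts.seq (halts_loop_searchProg hS₃ (h11₃.trans h11) h9) fun s₄ ⟨L, hS₄, ha⟩ _ => ?_
  refine Halts.seq (Halts.cond (fun h12 => ?_) (fun h12 => ?_)) fun s' h _ => .straight rfl le_rfl h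
  · obtain ⟨p, hp, hn⟩ := hS₄.found h12
    have hval := hS₄.explored.valid p (List.mem_of_getElem? hp)
    obtain ⟨σ, h1, hσ⟩ := exists_equiv_of_nodup hval.nodup hn
    refine (halts_outputProg hS₄.base hS₄.table hp hn hσ).mono (fun s₅ h5 _ => Or.inl ⟨σ, h5, ?_⟩)
      le_rfl
    rw [← pathCost_initialPath_card, h1]
    exact hval.pathCost_le
  · refine (Halts.straight (t := 1) (Q := fun s' => s'.reg 0 = 0) rfl le_rfl (by simp [exec])).mono
      (fun s₅ h5 _ => Or.inr ⟨h5, hS₄.not_exists ha h12 hT hr hk⟩) (by omega)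

/-! ### The time bound in terms of `k` -/

/-- In fact `r - 1 ≤ k ^ (1 / 3)` when `r > 1`. Then also `k ≥ 2`, so `√(log k) ≥ 1 / 2` because
`log 2 > 1 / 4`. -/
theorem le_rpow_mul_sqrt_log {k r : ℕ} (hr : r = 1 ∨ (r - 1) ^ 3 < k) :
    (r : ℝ) ≤ 1 + 2 * ((k : ℝ) ^ (1 / 3 : ℝ) * √(Real.log k)) := by
  have h0 : 0 ≤ (k : ℝ) ^ (1 / 3 : ℝ) * √(Real.log k) := by positivity
  by_cases h1 : r ≤ 1
  · have : (r : ℝ) ≤ 1 := by exact_mod_cast h1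
    linarith
  obtain ⟨q, rfl⟩ : ∃ q, r = q + 1 := ⟨r - 1, by omega⟩
  have hq : q ^ 3 < k := by simpa using hr.resolve_left (by omega)
  have hk : 2 ≤ k := by
    have : 1 ≤ q ^ 3 := Nat.one_le_pow _ _ (by omega)
    omega
  have hk' : (2 : ℝ) ≤ k := by exact_mod_cast hk
  have h2 : (q : ℝ) ≤ (k : ℝ) ^ (1 / 3 : ℝ) := by
    have h3 : (q : ℝ) ^ 3 ≤ k := by exact_mod_cast hq.le
    calc (q : ℝ) = ((q : ℝ) ^ 3) ^ (1 / 3 : ℝ) := by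
          rw [← Real.rpow_natCast, ← Real.rpow_mul (Nat.cast_nonneg _)]; norm_num
      _ ≤ _ := by gcongr
  have h3 : 1 / 2 ≤ √(Real.log k) := by
    refine Real.le_sqrt_of_sq_le ?_
    have h4 := Real.log_two_gt_d9
    have h5 := Real.log_le_log (by norm_num) hk'
    norm_num
    linarith
  have h6 : (k : ℝ) ^ (1 / 3 : ℝ) * (1 / 2) ≤ (k : ℝ) ^ (1 / 3 : ℝ) * √(Real.log k) := by gcongr
  push_cast
  linarith

end OLA

theorem mainTheorem4 :
    (∃ (P : RAM.Prog) (c : ℕ), ∀ (n : ℕ) (T : Digraph (Fin n)), OLA.IsSemicomplete T →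
      ∀ k : ℕ, ∃ (s : RAM.State) (t : ℕ),
        RAM.Runs P (OLA.inputState T k) s t ∧
        (t : ℝ) ≤ (c : ℝ) * (2 : ℝ) ^ ((c : ℝ) * (k : ℝ) ^ (1 / 3 : ℝ) * √(Real.log (k : ℝ))) *
          ((n : ℝ) + 1) ^ c ∧
        ((∃ σ : Fin n ≃ Fin n, OLA.Reports s σ ∧ OLA.cost T σ ≤ k) ∨
          (OLA.ReportsNone s ∧ ¬ ∃ σ : Fin n ≃ Fin n, OLA.cost T σ ≤ k))) ∧
    (∀ (n : ℕ) (T : Digraph (Fin n)), OLA.IsSemicomplete T → ∀ (k : ℕ) (σ : Fin n ≃ Fin n),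
      OLA.cost T σ ≤ k → ∀ t : ℕ, t ≤ n →
        OLA.IsCut T ((4 * (k : ℝ)) ^ (2 / 3 : ℝ)) (OLA.firstVertices σ t)) := by
  -- As a factor, `2 ^ 22` pays for the summand `1` in `r ≤ 1 + 2 * x`; as exponents, only `c ≥ 44`
  -- and `c ≥ 4` matter.
  refine ⟨⟨OLA.orderingProg, 1000 * 2 ^ 22, fun n T hT k => ?_⟩,
    fun n T _ k σ h t _ => OLA.isCut_firstVertices T k σ h t⟩
  obtain ⟨r, hr, s, t, hrun, ht, hs⟩ := OLA.halts_orderingProg hT k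
  refine ⟨s, t, hrun, ?_, hs⟩
  have h1 := OLA.le_rpow_mul_sqrt_log hr
  set x : ℝ := (k : ℝ) ^ (1 / 3 : ℝ) * √(Real.log k) with hx
  have hx0 : 0 ≤ x := by positivity
  set c : ℕ := 1000 * 2 ^ 22 with hc
  have hc44 : (44 : ℝ) ≤ c := by rw [hc]; norm_num
  have h2 : (2 : ℝ) ^ (22 * r) ≤ 2 ^ 22 * (2 : ℝ) ^ ((c : ℝ) * x) := by
    rw [← Real.rpow_natCast 2 (22 * r), ← Real.rpow_natCast 2 22,
      ← Real.rpow_add (by norm_num)]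
    refine Real.rpow_le_rpow_of_exponent_le (by norm_num) ?_
    push_cast
    nlinarith
  have h3 : ((n : ℝ) + 1) ^ 4 ≤ ((n : ℝ) + 1) ^ c :=
    pow_le_pow_right₀ (by linarith [(Nat.cast_nonneg n : (0 : ℝ) ≤ n)]) (by rw [hc]; norm_num)
  have h4 : (t : ℝ) ≤ 1000 * ((n : ℝ) + 1) ^ 4 * 2 ^ (22 * r) := by exact_mod_cast ht
  rw [mul_assoc (c : ℝ) _ (√_), ← hx]
  calc (t : ℝ) ≤ 1000 * ((n : ℝ) + 1) ^ 4 * 2 ^ (22 * r) := h4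
    _ ≤ 1000 * ((n : ℝ) + 1) ^ c * (2 ^ 22 * (2 : ℝ) ^ ((c : ℝ) * x)) := by gcongr
    _ = (c : ℝ) * (2 : ℝ) ^ ((c : ℝ) * x) * ((n : ℝ) + 1) ^ c := by
      have : (c : ℝ) = 1000 * 2 ^ 22 := by rw [hc]; norm_num
      generalize ((n : ℝ) + 1) ^ c = y
      generalize (2 : ℝ) ^ ((c : ℝ) * x) = z
      rw [this]
      ring
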